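/- **Setting.** Let $A=\mathbb F_q[T]$, $K=\mathbb F_q(T)$, $K_\infty$ the completion of $K$ at $1/T$ (with $|T|=q$), $\mathbb C_\infty$ the completion of an algebraic closure of $K_\infty$, and $\Omega=\mathbb C_\infty\setminus K_\infty$ the Drinfeld upper half-plane, on which $GL_2(K)$ acts by fractional linear transformations. For $\gamma=\begin{pmatrix}a&b\\c&d\end{pmatrix}\in GL_2(K)$, $k,m\in\mathbb Z$ and $f:\Omega\to\mathbb C_\infty$ put $(f|_{k,m}\gamma)(z)=(\det\gamma)^m(cz+d)^{-k}f(\gamma z)$. For an ideal $\mathfrak m\subseteq A$, $\Gamma_0(\mathfrak m)\subseteq GL_2(A)$ is the group of matrices with $c\in\mathfrak m$; let $\Gamma$ denote such a group with $\mathfrak m\neq0$. **Forms.** A rigid analytic $f:\Omega\to\mathbb C_\infty$ is a Drinfeld quasi-modular form of weight $k$, type $m$ and depth $\le\ell$ for $\Gamma$, written $f\in\widetilde M^{\le\ell}_{k,m}(\Gamma)$, if there are rigid analytic functions $f_0,\dots,f_\ell$ on $\Omega$, each periodic under some nonzero ideal of $A$, such that $(f|_{k,m}\gamma)(z)=\sum_{i=0}^\ell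 f_i(z)\left(\frac{c}{cz+d}\right)^i$ for all $z\in\Omega$ and $\gamma\in\Gamma$, and such that for all $i$ and all $\gamma\in GL_2(K)$ the function $f_i|_{k-2i,m-i}\gamma$ is bounded as $\inf_{x\in K_\infty}|z-x|\to\infty$. The polynomial $P_f=\sum_i f_iX^i$ is the (unique) associated polynomial of $f$. Put $M_{k,m}(\Gamma)=\widetilde M^{\le0}_{k,m}(\Gamma)$ (modular forms). **The false Eisenstein series.** Let $\tilde\pi$ be a fixed period of the Carlitz module, i.e. $\tilde\pi\ne0$ and the zero set of $e_C(z)=\sum_{i\ge0}z^{q^i}/\prod_{j<i}(T^{q^i}-T^{q^j})$ is $\tilde\pi A$. Put $E(z)=\tilde\pi^{-1}\sum_{a\in A\text{ monic}}\ \sum_{b\in A}\frac{a}{az+b}$. The $E$-expansion of $f\in\widetilde M^{\le\ell}_{k,m}(\Gamma)$ is $f=\sum_{i=0}^\ell f_{i,E}E^i$, where $f_{i,E}=(-\tilde\pi)^i\sum_{h=i}^\ell\binom hi f_h(\tilde\pi E)^{h-i}\in M_{k-2i,m-i}(\Gamma)$. **Operators.** For $\gamma\in GL_2(K)$ and $f\in\widetilde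 M^{\le\ell}_{k,m}(\Gamma)$ put $(f\|_{k,m}\gamma)(z)=\sum_i\left(\frac{-c}{cz+d}\right)^i(f_i|_{k-2i,m-i}\gamma)(z)$, and for $\eta\in GL_2(K)$ put $T_\eta(f)=(\det\eta)^{k-m}\sum_\gamma f\|_{k,m}\gamma$, with $\gamma$ running over any finite set of representatives of $\Gamma\backslash\Gamma\eta\Gamma$. Let $\mathfrak p=(\wp)$ be a prime of $A$ with $\wp$ monic, let $\mathfrak m$ be a nonzero ideal with $\mathfrak p\nmid\mathfrak m$, and let $\eta=\begin{pmatrix}1&0\\0&\wp\end{pmatrix}$. Then $T_{\mathfrak p}$ is $T_\eta$ for $\Gamma_0(\mathfrak m)$ and $U_{\mathfrak p}$ is $T_\eta$ for $\Gamma_0(\mathfrak m\mathfrak p)$. Put $(\delta_{\mathfrak p}f)(z)=f(\wp z)$ and $E_{\mathfrak p}=E-\wp\,\delta_{\mathfrak p}E$. **Theorem.** Let $n\ge0$, $k,m\in\mathbb Z$ and $f\in M_{k-2n,m-n}(\Gamma_0(\mathfrak m))$. Then $fE^n\in\widetilde M^{\le n}_{k,m}(\Gamma_0(\mathfrak m))$,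 $fE_{\mathfrak p}^{n-h}\in M_{k-2h,m-h}(\Gamma_0(\mathfrak m\mathfrak p))$ for $0\le h\le n$ (so that $T_{\mathfrak p}$ and $U_{\mathfrak p}$ apply to them), $T_{\mathfrak p}(fE^n)\in\widetilde M^{\le n}_{k,m}(\Gamma_0(\mathfrak m))$, and its $E$-expansion is $$T_{\mathfrak p}(fE^n)=\sum_{h=0}^n\binom nh\wp^h\Bigl[\wp^{k-n-h}\,\delta_{\mathfrak p}f\,(-E_{\mathfrak p})^{n-h}+U_{\mathfrak p}\bigl(fE_{\mathfrak p}^{n-h}\bigr)\Bigr]E^h ;$$ that is, for $0\le h\le n$ the coefficient of $E^h$ on the right is $(T_{\mathfrak p}(fE^n))_{h,E}$, and lies in $M_{k-2h,m-h}(\Gamma_0(\mathfrak m))$. -/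

import Mathlib

open Polynomial
open scoped NNReal WithZero

noncomputable section

namespace DrinfeldQM

/-! ### The fields `K_∞` and `ℂ_∞`

`F` is the finite field `𝔽_q`, `F[X]` is `A = 𝔽_q[T]`, and `RatFunc F` is `K = 𝔽_q(T)`. -/

/-- `K_∞`: the completion of `𝔽_q(T)` at the place `∞ = 1/T`. -/
abbrev KInf (F : Type*) [Field F] : Type _ :=
  @RatFunc.CompletionAtInfty F _ (Classical.decEq _)

theorem valued_KInf_algebraMap (F : Type*) [Field F] (r : RatFunc F) :
    (Valued.v : Valuation (KInf F) ℤᵐ⁰) (algebraMap (RatFunc F) (KInf F) r) =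
      @RatFunc.inftyValuation F _ (Classical.decEq _) r := by
  exact @Valued.extensionValuation_apply_coe (RatFunc F) _ ℤᵐ⁰ _
    (@RatFunc.inftyValued F _ (Classical.decEq _)) r

/-- The cardinality `q` of the constant field, as a nonnegative real number. -/
def qCard (F : Type*) [Fintype F] : ℝ≥0 := (Fintype.card F : ℝ≥0)

theorem one_lt_qCard (F : Type*) [Field F] [Fintype F] : 1 < qCard F := by
  unfold qCard
  exact_mod_cast Fintype.one_lt_card

/-- The valuation at infinity has rank one; the embedding of its value group in the positive
reals is normalised by `|T| = q`. -/
instance instRankOneKInf (F : Type*) [Field F] [Fintype F] :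
    (Valued.v : Valuation (KInf F) ℤᵐ⁰).RankOne where
  hom' := (WithZeroMulInt.toNNReal (one_lt_qCard F).ne_zero).comp
    MonoidWithZeroHom.ValueGroup₀.embedding
  strictMono' := (WithZeroMulInt.toNNReal_strictMono (one_lt_qCard F)).comp
    MonoidWithZeroHom.ValueGroup₀.embedding_strictMono
  exists_val_nontrivial := by
    refine ⟨algebraMap (RatFunc F) (KInf F) RatFunc.X, ?_, ?_⟩
    · rw [valued_KInf_algebraMap, RatFunc.inftyValuation.X]
      exact WithZero.exp_ne_zero
    · rw [valued_KInf_algebraMap, RatFunc.inftyValuation.X]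
      simp [← WithZero.exp_zero]

/-- `K_∞` with the absolute value `|·|_∞`, normalised by `|T|_∞ = q`. -/
instance instNormedKInf (F : Type*) [Field F] [Fintype F] : NontriviallyNormedField (KInf F) :=
  Valued.toNontriviallyNormedField (KInf F) ℤᵐ⁰

instance instCompleteKInf (F : Type*) [Field F] [Fintype F] : CompleteSpace (KInf F) :=
  inferInstanceAs (CompleteSpace (@UniformSpace.Completion (RatFunc F)
    (@RatFunc.inftyValued F _ (Classical.decEq _)).toUniformSpace))

instance instUltraKInf (F : Type*) [Field F] [Fintype F] : IsUltrametricDist (KInf F) :=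
  inferInstanceAs (@IsUltrametricDist (KInf F) (Valued.toNormedField (KInf F) ℤᵐ⁰).toDist)

/-- On `K` the absolute value is `|r|_∞ = q ^ deg r`. -/
theorem norm_KInf_algebraMap (F : Type*) [Field F] [Fintype F] (r : RatFunc F) (hr : r ≠ 0) :
    ‖algebraMap (RatFunc F) (KInf F) r‖ = (Fintype.card F : ℝ) ^ r.intDegree := by
  change ((WithZeroMulInt.toNNReal (one_lt_qCard F).ne_zero
    (MonoidWithZeroHom.ValueGroup₀.embedding ((Valued.v : Valuation (KInf F) ℤᵐ⁰).restrict
      (algebraMap (RatFunc F) (KInf F) r))) : ℝ≥0) : ℝ) = _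
  rw [Valuation.embedding_restrict, valued_KInf_algebraMap, RatFunc.inftyValuation_apply,
    @RatFunc.inftyValuation_of_nonzero F _ (Classical.decEq _) r hr,
    WithZeroMulInt.toNNReal_neg_apply _ WithZero.exp_ne_zero]
  simp [qCard, WithZero.exp]

/-- An algebraic closure of `K_∞`, with the unique extension of the absolute value of `K_∞`. -/
abbrev AlgClInf (F : Type*) [Field F] : Type _ := AlgebraicClosure (KInf F)

instance instNormedAlgClInf (F : Type*) [Field F] [Fintype F] :
    NontriviallyNormedField (AlgClInf F) :=
  spectralNorm.nontriviallyNormedField (KInf F) (AlgClInf F)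

instance instNormedAlgebraAlgClInf (F : Type*) [Field F] [Fintype F] :
    NormedAlgebra (KInf F) (AlgClInf F) :=
  spectralNorm.normedAlgebra _ _

/-- `ℂ_∞`: the completion of an algebraic closure of `K_∞`. -/
abbrev CInf (F : Type*) [Field F] [Fintype F] : Type _ := UniformSpace.Completion (AlgClInf F)

section

variable {F : Type*} [Field F] [Fintype F]

/-- The embedding of `K = 𝔽_q(T)` in `ℂ_∞`. -/
def embK : RatFunc F →+* CInf F :=
  (algebraMap (KInf F) (CInf F)).comp (algebraMap (RatFunc F) (KInf F))

/-- The embedding of `A = 𝔽_q[T]` in `ℂ_∞`. -/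
def embA : F[X] →+* CInf F := embK.comp (algebraMap F[X] (RatFunc F))

/-! ### The Drinfeld upper half-plane -/

variable (F) in
/-- The Drinfeld upper half-plane `Ω = ℙ¹(ℂ_∞) ∖ ℙ¹(K_∞) = ℂ_∞ ∖ K_∞`. -/
def Omega : Type _ := {z : CInf F // z ∉ Set.range (algebraMap (KInf F) (CInf F))}

instance : CoeOut (Omega F) (CInf F) := ⟨Subtype.val⟩

/-- The imaginary part `|z|_i = inf {|z - x| : x ∈ K_∞}`. -/
def imAbs (z : Omega F) : ℝ :=
  Metric.infDist (z : CInf F) (Set.range (algebraMap (KInf F) (CInf F)))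

/-- The affinoid `Ω_n = {z ∈ Ω : |z| ≤ q ^ n, |z|_i ≥ q ^ (-n)}`. The sets `Ω_n` form the usual
admissible covering of `Ω`. -/
def OmegaAff (n : ℕ) : Set (Omega F) :=
  {z | ‖(z : CInf F)‖ ≤ (Fintype.card F : ℝ) ^ n ∧ ((Fintype.card F : ℝ) ^ n)⁻¹ ≤ imAbs z}

/-- `f : Ω → ℂ_∞` is rigid analytic: on each affinoid `Ω_n` it is a uniform limit of rational
functions without poles in `Ω_n`. -/
def IsRigidAnalytic (f : Omega F → CInf F) : Prop :=
  ∀ n : ℕ, ∀ ε : ℝ, 0 < ε → ∃ P Q : (CInf F)[X],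
    (∀ z ∈ OmegaAff (F := F) n, Q.eval (z : CInf F) ≠ 0) ∧
      ∀ z ∈ OmegaAff (F := F) n, ‖f z - P.eval (z : CInf F) / Q.eval (z : CInf F)‖ ≤ ε

/-- `f` is `I`-periodic for some nonzero ideal `I` of `A`. -/
def IsPeriodic (f : Omega F → CInf F) : Prop :=
  ∃ I : Ideal F[X], I ≠ ⊥ ∧ ∀ a ∈ I, ∀ z w : Omega F,
    (w : CInf F) = (z : CInf F) + embA a → f w = f z

/-- `f` belongs to the ring `𝒪` of rigid analytic functions on `Ω` that are `I`-periodic for some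
nonzero ideal `I` of `A`. -/
def MemO (f : Omega F → CInf F) : Prop := IsRigidAnalytic f ∧ IsPeriodic f

/-! ### The action of `GL₂(K)` -/

/-- `c z + d` for `γ = (a b; c d)`. -/
def denom (γ : GL (Fin 2) (RatFunc F)) (z : Omega F) : CInf F :=
  embK (γ 1 0) * (z : CInf F) + embK (γ 1 1)

theorem embK_det_ne_zero (γ : GL (Fin 2) (RatFunc F)) :
    embK (γ 0 0) * embK (γ 1 1) - embK (γ 0 1) * embK (γ 1 0) ≠ (0 : CInf F) := by
  have h : (γ : Matrix (Fin 2) (Fin 2) (RatFunc F)).det ≠ 0 :=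
    ((Matrix.isUnit_iff_isUnit_det _).1 γ.isUnit).ne_zero
  rw [Matrix.det_fin_two] at h
  rw [← map_mul, ← map_mul, ← map_sub]
  exact fun h0 => h ((map_eq_zero embK).1 h0)

theorem eq_zero_of_mul_mem {r s : KInf F} (z : Omega F)
    (h : algebraMap (KInf F) (CInf F) r * (z : CInf F) = algebraMap (KInf F) (CInf F) s) :
    r = 0 := by
  by_contra hr
  refine z.2 ⟨s / r, ?_⟩
  rw [map_div₀, ← h, mul_div_cancel_left₀]
  exact (_root_.map_ne_zero _).2 hr

theorem denom_ne_zero (γ : GL (Fin 2) (RatFunc F)) (z : Omega F) : denom γ z ≠ 0 := by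
  intro h
  have hd := embK_det_ne_zero γ
  have hc : algebraMap (RatFunc F) (KInf F) (γ 1 0) = 0 := by
    refine eq_zero_of_mul_mem (s := - algebraMap (RatFunc F) (KInf F) (γ 1 1)) z ?_
    rw [map_neg]
    exact eq_neg_of_add_eq_zero_left h
  have hc' : embK (γ 1 0) = (0 : CInf F) := by simp [embK, hc]
  have hd' : embK (γ 1 1) = (0 : CInf F) := by simpa [denom, hc'] using h
  exact hd (by rw [hc', hd']; ring)

/-- The action of `GL₂(K)` on `Ω` by fractional linear transformations
`γ z = (a z + b) / (c z + d)`. -/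
def mob (γ : GL (Fin 2) (RatFunc F)) (z : Omega F) : Omega F :=
  ⟨(embK (γ 0 0) * (z : CInf F) + embK (γ 0 1)) / denom γ z, by
    rintro ⟨x, hx⟩
    rw [eq_div_iff (denom_ne_zero γ z), denom] at hx
    have hd := embK_det_ne_zero γ
    have key : algebraMap (KInf F) (CInf F)
        (algebraMap (RatFunc F) (KInf F) (γ 0 0) - x * algebraMap (RatFunc F) (KInf F) (γ 1 0)) *
          (z : CInf F) = algebraMap (KInf F) (CInf F)
        (x * algebraMap (RatFunc F) (KInf F) (γ 1 1) - algebraMap (RatFunc F) (KInf F) (γ 0 1)) := by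
      simp only [map_sub, map_mul]
      simp only [embK, RingHom.comp_apply] at hx
      linear_combination -hx
    have h0 := eq_zero_of_mul_mem z key
    rw [h0, map_zero, zero_mul] at key
    have h1 := congrArg (algebraMap (KInf F) (CInf F)) h0
    simp only [map_sub, map_mul, map_zero] at h1 key
    simp only [embK, RingHom.comp_apply] at hd
    apply hd
    linear_combination (algebraMap (KInf F) (CInf F)
      (algebraMap (RatFunc F) (KInf F) (γ 1 1))) * h1 + (algebraMap (KInf F) (CInf F)
      (algebraMap (RatFunc F) (KInf F) (γ 1 0))) * (-key)⟩

/-- `c / (c z + d)` for `γ = (a b; c d)`. -/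
def kappa (γ : GL (Fin 2) (RatFunc F)) (z : Omega F) : CInf F :=
  embK (γ 1 0) / denom γ z

/-- The slash operator `(f |_{k,m} γ)(z) = (det γ)^m (c z + d)^{-k} f(γ z)`. -/
def slash (k m : ℤ) (f : Omega F → CInf F) (γ : GL (Fin 2) (RatFunc F)) : Omega F → CInf F :=
  fun z => embK (γ : Matrix (Fin 2) (Fin 2) (RatFunc F)).det ^ m * denom γ z ^ (-k) * f (mob γ z)

/-- The Hecke congruence subgroup `Γ₀(𝔪) = {(a b; c d) ∈ GL₂(A) : c ∈ 𝔪}`, inside `GL₂(A)`. -/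
def Gamma0A (𝔪 : Ideal F[X]) : Subgroup (GL (Fin 2) F[X]) where
  carrier := {γ | γ 1 0 ∈ 𝔪}
  one_mem' := by simp
  mul_mem' := by
    intro a b ha hb
    simp only [Set.mem_ofPred_eq, Units.val_mul, Matrix.mul_apply, Fin.sum_univ_two] at *
    exact 𝔪.add_mem (𝔪.mul_mem_right _ ha) (𝔪.mul_mem_left _ hb)
  inv_mem' := by
    intro a ha
    simp only [Set.mem_ofPred_eq] at *
    rw [Matrix.coe_units_inv, Matrix.inv_def, Matrix.adjugate_fin_two]
    simp only [Matrix.smul_apply, Matrix.of_apply, Matrix.cons_val', Matrix.cons_val_zero,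
      Matrix.cons_val_one, Matrix.cons_val_fin_one, smul_eq_mul]
    exact 𝔪.mul_mem_left _ (𝔪.neg_mem ha)

/-- The Hecke congruence subgroup `Γ₀(𝔪)` as a subgroup of `GL₂(K)`. -/
def Gamma0 (𝔪 : Ideal F[X]) : Subgroup (GL (Fin 2) (RatFunc F)) :=
  (Gamma0A 𝔪).map (Matrix.GeneralLinearGroup.map (algebraMap F[X] (RatFunc F)))

/-! ### Quasi-modular forms -/

/-- `P = ∑ f_i X^i ∈ 𝒪[X]` is an associated polynomial of the function `f`, of weight `k` and type
`m` for `Γ`: `(f |_{k,m} γ)(z) = ∑ f_i(z) (c / (c z + d))^i` for all `γ = (a b; c d) ∈ Γ`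
and all `z ∈ Ω`. -/
def IsAssocPoly (Γ : Subgroup (GL (Fin 2) (RatFunc F))) (k m : ℤ) (f : Omega F → CInf F)
    (P : (Omega F → CInf F)[X]) : Prop :=
  (∀ i, MemO (P.coeff i)) ∧
    ∀ γ ∈ Γ, ∀ z, slash k m f γ z =
      ∑ i ∈ Finset.range (P.natDegree + 1), P.coeff i z * kappa γ z ^ i

/-- The associated polynomial `P_f` of `f` (and `0` if there is none). -/
def assocPoly (Γ : Subgroup (GL (Fin 2) (RatFunc F))) (k m : ℤ) (f : Omega F → CInf F) :
    (Omega F → CInf F)[X] :=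
  open Classical in if h : ∃ P, IsAssocPoly Γ k m f P then h.choose else 0

/-- `f` is bounded on vertical lines: `|f(z)|` is bounded as `|z|_i → ∞`. -/
def BoundedOnVerticalLines (f : Omega F → CInf F) : Prop :=
  ∃ B R : ℝ, ∀ z : Omega F, R ≤ imAbs z → ‖f z‖ ≤ B

/-- `f ∈ M̃_{k,m}^{≤ ℓ}(Γ)`: `f` is a Drinfeld quasi-modular form of weight `k`, type `m` and depth
at most `ℓ` for `Γ`. -/
def IsQuasiModularForm (Γ : Subgroup (GL (Fin 2) (RatFunc F))) (k m : ℤ) (ℓ : ℕ)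
    (f : Omega F → CInf F) : Prop :=
  IsRigidAnalytic f ∧ ∃ P : (Omega F → CInf F)[X], IsAssocPoly Γ k m f P ∧ P.natDegree ≤ ℓ ∧
    ∀ i : ℕ, ∀ γ : GL (Fin 2) (RatFunc F),
      BoundedOnVerticalLines (slash (k - 2 * i) (m - i) (P.coeff i) γ)

/-- `f ∈ M_{k,m}(Γ)`: `f` is a Drinfeld modular form of weight `k` and type `m` for `Γ`, that is, a
quasi-modular form of depth `0`. -/
def IsModularForm (Γ : Subgroup (GL (Fin 2) (RatFunc F))) (k m : ℤ) (f : Omega F → CInf F) :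
    Prop :=
  IsQuasiModularForm Γ k m 0 f

/-- The double-slash operator on a quasi-modular form `f` with associated polynomial
`P_f = ∑ f_i X^i`:
`(f ‖_{k,m} γ)(z) = ∑ (-c / (c z + d))^i (f_i |_{k-2i,m-i} γ)(z)`. -/
def doubleSlash (Γ : Subgroup (GL (Fin 2) (RatFunc F))) (k m : ℤ) (f : Omega F → CInf F)
    (γ : GL (Fin 2) (RatFunc F)) : Omega F → CInf F :=
  fun z => ∑ i ∈ Finset.range ((assocPoly Γ k m f).natDegree + 1),
    (-kappa γ z) ^ i * slash (k - 2 * i) (m - i) ((assocPoly Γ k m f).coeff i) γ z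

/-! ### Hecke operators -/

/-- `R` is a finite set of representatives for the orbit space `Γ \ Γ η Γ`. -/
def IsCosetReps (Γ : Subgroup (GL (Fin 2) (RatFunc F))) (η : GL (Fin 2) (RatFunc F))
    (R : Finset (GL (Fin 2) (RatFunc F))) : Prop :=
  (∀ r ∈ R, r ∈ DoubleCoset.doubleCoset η (Γ : Set (GL (Fin 2) (RatFunc F))) Γ) ∧
    ∀ δ ∈ DoubleCoset.doubleCoset η (Γ : Set (GL (Fin 2) (RatFunc F))) Γ,
      ∃! r, r ∈ R ∧ δ * r⁻¹ ∈ Γ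

/-- The Hecke operator `T_η(f) = (det η)^{k-m} ∑_γ f ‖_{k,m} γ` in weight `k` and type `m`, where
`γ` runs over a set `R` of representatives for `Γ \ Γ η Γ`. -/
def hecke (Γ : Subgroup (GL (Fin 2) (RatFunc F))) (η : GL (Fin 2) (RatFunc F))
    (R : Finset (GL (Fin 2) (RatFunc F))) (k m : ℤ) (f : Omega F → CInf F) : Omega F → CInf F :=
  fun z => embK (η : Matrix (Fin 2) (Fin 2) (RatFunc F)).det ^ (k - m) *
    ∑ γ ∈ R, doubleSlash Γ k m f γ z

/-- The diagonal matrix `(a 0; 0 d)` in `GL₂(K)`, for nonzero `a, d ∈ A`. -/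
def diagGL (a d : F[X]) (ha : a ≠ 0) (hd : d ≠ 0) : GL (Fin 2) (RatFunc F) :=
  Matrix.GeneralLinearGroup.mkOfDetNeZero
    !![algebraMap F[X] (RatFunc F) a, 0; 0, algebraMap F[X] (RatFunc F) d]
    (by
      rw [Matrix.det_fin_two_of, mul_zero, sub_zero]
      exact mul_ne_zero ((map_ne_zero_iff _ (RatFunc.algebraMap_injective F)).2 ha)
        ((map_ne_zero_iff _ (RatFunc.algebraMap_injective F)).2 hd))

/-- The matrix `(1 0; 0 ϖ)` defining the Hecke operators `T_𝔭` and `U_𝔭` for `𝔭 = (ϖ)`. -/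
def heckeMat (ϖ : F[X]) (h : ϖ ≠ 0) : GL (Fin 2) (RatFunc F) := diagGL 1 ϖ one_ne_zero h

/-- The degeneracy map `(δ_𝔭 f)(z) = f(ϖ z)` for `𝔭 = (ϖ)`; here `ϖ z` is the image of `z` under
the matrix `(ϖ 0; 0 1)`. -/
def degeneracy (ϖ : F[X]) (h : ϖ ≠ 0) (f : Omega F → CInf F) : Omega F → CInf F :=
  fun z => f (mob (diagGL ϖ 1 h one_ne_zero) z)

/-! ### The false Eisenstein series and `E`-expansions -/

/-- `D_i = ∏_{j < i} (T^{q^i} - T^{q^j})`. -/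
def carlitzD (F : Type*) [Field F] [Fintype F] (i : ℕ) : F[X] :=
  ∏ j ∈ Finset.range i, (X ^ Fintype.card F ^ i - X ^ Fintype.card F ^ j)

/-- The Carlitz exponential `e_C(z) = ∑_{i ≥ 0} z^{q^i} / D_i`, the exponential function of the
Carlitz module `C_T = T τ^0 + τ`. -/
def carlitzExp (z : CInf F) : CInf F :=
  ∑' i : ℕ, z ^ Fintype.card F ^ i / embA (carlitzD F i)

/-- `π` is a period of the Carlitz module: a basis of the free rank one `A`-module of zeros of the
Carlitz exponential. -/
def IsCarlitzPeriod (π : CInf F) : Prop :=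
  π ≠ 0 ∧ ∀ z : CInf F, carlitzExp z = 0 ↔ ∃ a : F[X], z = π * embA a

/-- The false Eisenstein series
`E(z) = π⁻¹ ∑_{a ∈ A monic} ∑_{b ∈ A} a / (a z + b)`. -/
def falseE (π : CInf F) : Omega F → CInf F :=
  fun z => π⁻¹ * ∑' a : {a : F[X] // a.Monic}, ∑' b : F[X],
    embA a.1 / (embA a.1 * (z : CInf F) + embA b)

/-- The `𝔭`-stabilization `E_𝔭 = E - ϖ δ_𝔭 E` of `E`, for `𝔭 = (ϖ)`. -/
def stabE (π : CInf F) (ϖ : F[X]) (h : ϖ ≠ 0) : Omega F → CInf F :=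
  fun z => falseE π z - embA ϖ * degeneracy ϖ h (falseE π) z

/-- The coefficient `f_{i,E} = (-π)^i ∑_{h ≥ i} (h choose i) f_h (π E)^{h-i}` of the `E`-expansion
of a quasi-modular form `f` with associated polynomial `P_f = ∑ f_h X^h`. -/
def eCoeff (π : CInf F) (Γ : Subgroup (GL (Fin 2) (RatFunc F))) (k m : ℤ) (f : Omega F → CInf F)
    (i : ℕ) : Omega F → CInf F :=
  fun z => (-π) ^ i * ∑ h ∈ Finset.Icc i (assocPoly Γ k m f).natDegree,
    (h.choose i : CInf F) * (assocPoly Γ k m f).coeff h z * (π * falseE π z) ^ (h - i)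

/-- `f ∈ M̃_{k,m}^{≤ ℓ}(Γ)` has the `E`-expansion `f = ∑_{i ≤ ℓ} c_i E^i`. The coefficients
`c_i` are the functions `f_{i,E}`, and they are modular forms in `M_{k-2i,m-i}(Γ)`. -/
structure HasEExpansion (π : CInf F) (Γ : Subgroup (GL (Fin 2) (RatFunc F))) (k m : ℤ) (ℓ : ℕ)
    (f : Omega F → CInf F) (c : ℕ → Omega F → CInf F) : Prop where
  isQuasiModularForm : IsQuasiModularForm Γ k m ℓ f
  coeff_eq : ∀ i ≤ ℓ, c i = eCoeff π Γ k m f i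
  coeff_isModularForm : ∀ i ≤ ℓ, IsModularForm Γ (k - 2 * i) (m - i) (c i)
  eq_sum : ∀ z, f z = ∑ i ∈ Finset.range (ℓ + 1), c i z * falseE π z ^ i

end

end DrinfeldQM

end

open DrinfeldQM

set_option linter.unusedSectionVars false

noncomputable section

namespace DrinfeldQM

variable {F : Type*} [Field F] [Fintype F]

/-! ### Norms on `ℂ_∞` -/

/-! Everything is read off from one function, `dslashE`: $E\|\gamma = E|_{2,1}\gamma +
\tilde\pi^{-1}c/(cz+d)$. Since $c/(cz+d)$ is a cocycle (`kappa_mul`), $E\|(\gamma\delta) =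
(E\|\gamma)|_{2,1}\delta + \tilde\pi^{-1}\kappa_\delta$. Hence the $\gamma$ with $E\|\gamma=E$ form
a group, $E\|\gamma$ depends only on the left coset of $\gamma$ under it, and differences
$E\|\gamma-E\|\gamma'$ transform by the plain slash operator.

That group contains $GL_2(A)$ (`Gamma0_le_stabilizerE`). By Euclid's algorithm it suffices to treat
upper triangular matrices and $z\mapsto-1/z$. For the inversion, $\tilde\pi E$ is the limit of sums
over the square box $\deg a,\deg b<N$. Swapping $a$ and $b$ preserves the box, and the terms $a=0$
leave the anomaly $z$. The same reduction to triangular matrices bounds $E\|\gamma$ on vertical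
lines for every $\gamma\in GL_2(K)$.

For modular $c_h$, the form $\sum c_hE^h$ has associated polynomial $\sum c_h(E-\tilde\pi^{-1}X)^h$,
which is unique because $\kappa_\gamma(z)$ takes infinitely many values. So $\|\gamma$ replaces
$c_h$ by its slash and $E$ by $E\|\gamma$ (`doubleSlash_sum`), and the $c_h$ are the coefficients of
the $E$-expansion (`eCoeff_sum`).

Expanding $(fE^n)\|\gamma = (f|\gamma)\,(E+(E\|\gamma-E))^n$ gives, up to $\binom nh$ and a power of
$\wp$, the coefficient $\sum_\gamma (f|\gamma)(E\|\gamma-E)^{n-h}$ of $E^h$. It is modular because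
right multiplication by $\Gamma_0(\mathfrak m)$ permutes the cosets (`isModularForm_sum_heckeTerm`).
The cosets for $T_{\mathfrak p}$ are those for $U_{\mathfrak p}$ and that of $\mathrm{diag}(\wp,1)$
(`IsCosetReps.sum_eq_add_sum`). On the last one $E\|\gamma-E=-E_{\mathfrak p}$. On the others
$E\|\gamma-E=E_{\mathfrak p}|\gamma$ (`slash_stabE_of_mem_doubleCoset`), so their sum is
$U_{\mathfrak p}(fE_{\mathfrak p}^{n-h})$ up to a power of $\wp$. -/

instance instUltraCInf : IsUltrametricDist (CInf F) := by
  rw [isUltrametricDist_iff_forall_norm_natCast_le_one]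
  intro n
  rw [← map_natCast (algebraMap (KInf F) (CInf F)) n, norm_algebraMap']
  exact IsUltrametricDist.norm_natCast_le_one (KInf F) n

theorem one_lt_card : (1 : ℝ) < Fintype.card F := by exact_mod_cast Fintype.one_lt_card

theorem card_pos : (0 : ℝ) < Fintype.card F := zero_lt_one.trans one_lt_card

theorem norm_embA {a : F[X]} (ha : a ≠ 0) :
    ‖(embA a : CInf F)‖ = (Fintype.card F : ℝ) ^ a.natDegree := by
  have h : algebraMap F[X] (RatFunc F) a ≠ 0 :=
    (map_ne_zero_iff _ (RatFunc.algebraMap_injective F)).2 ha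
  simp only [embA, embK, RingHom.comp_apply]
  rw [norm_algebraMap', norm_KInf_algebraMap F _ h, RatFunc.intDegree_polynomial, zpow_natCast]

theorem embA_injective : Function.Injective (embA : F[X] → CInf F) :=
  (RingHom.injective (embK (F := F))).comp (RatFunc.algebraMap_injective F)

theorem embA_ne_zero {a : F[X]} (ha : a ≠ 0) : (embA a : CInf F) ≠ 0 :=
  (map_ne_zero_iff _ embA_injective).2 ha

theorem embK_algebraMap (a : F[X]) :
    (embK (algebraMap F[X] (RatFunc F) a) : CInf F) = embA a := rfl

/-- The source of all cancellation below: constants summed over the field of constants vanish. -/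
theorem card_cast_eq_zero : ((Fintype.card F : ℕ) : CInf F) = 0 := by
  rw [← map_natCast (embA.comp C : F →+* CInf F), Nat.cast_card_eq_zero, map_zero]

theorem norm_add_eq_right {x y : CInf F} (h : ‖x‖ < ‖y‖) : ‖x + y‖ = ‖y‖ := by
  rw [IsUltrametricDist.norm_add_eq_max_of_norm_ne_norm h.ne, max_eq_right h.le]

/-! ### The imaginary part -/

theorem isClosed_range_KInf : IsClosed (Set.range (algebraMap (KInf F) (CInf F))) :=
  (algebraMap_isometry (KInf F) (CInf F)).isClosedEmbedding.isClosed_range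

theorem imAbs_pos (z : Omega F) : 0 < imAbs z :=
  (isClosed_range_KInf.notMem_iff_infDist_pos ⟨_, 0, rfl⟩).1 z.2

theorem imAbs_le (z : Omega F) (x : KInf F) :
    imAbs z ≤ ‖(z : CInf F) - algebraMap (KInf F) (CInf F) x‖ := by
  rw [← dist_eq_norm]
  exact Metric.infDist_le_dist_of_mem ⟨x, rfl⟩

theorem imAbs_le_norm (z : Omega F) : imAbs z ≤ ‖(z : CInf F)‖ := by
  simpa using imAbs_le z 0

theorem Omega.ne_zero (z : Omega F) : (z : CInf F) ≠ 0 :=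
  norm_pos_iff.1 ((imAbs_pos z).trans_le (imAbs_le_norm z))

theorem norm_mul_imAbs_le (z : Omega F) (u v : KInf F) :
    ‖u‖ * imAbs z ≤ ‖algebraMap (KInf F) (CInf F) u * z + algebraMap (KInf F) (CInf F) v‖ := by
  rcases eq_or_ne u 0 with rfl | hu
  · simp
  have hu' : algebraMap (KInf F) (CInf F) u ≠ 0 := (_root_.map_ne_zero _).2 hu
  have h : algebraMap (KInf F) (CInf F) u * z + algebraMap (KInf F) (CInf F) v =
      algebraMap (KInf F) (CInf F) u * (z - algebraMap (KInf F) (CInf F) (-v / u)) := by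
    rw [map_div₀, map_neg]
    field_simp
    ring
  rw [h, norm_mul, norm_algebraMap']
  gcongr
  exact imAbs_le z _

theorem norm_embA_mul_imAbs_le (z : Omega F) (a b : F[X]) :
    ‖(embA a : CInf F)‖ * imAbs z ≤ ‖embA a * (z : CInf F) + embA b‖ := by
  have h := norm_mul_imAbs_le z (algebraMap (RatFunc F) (KInf F) (algebraMap F[X] (RatFunc F) a))
    (algebraMap (RatFunc F) (KInf F) (algebraMap F[X] (RatFunc F) b))
  rwa [← norm_algebraMap' (CInf F)] at h

theorem norm_embK_mul_imAbs_le (γ : GL (Fin 2) (RatFunc F)) (z : Omega F) :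
    ‖(embK (γ 1 0) : CInf F)‖ * imAbs z ≤ ‖denom γ z‖ := by
  have h := norm_mul_imAbs_le z (algebraMap (RatFunc F) (KInf F) (γ 1 0))
    (algebraMap (RatFunc F) (KInf F) (γ 1 1))
  rwa [← norm_algebraMap' (CInf F)] at h

theorem embA_mul_add_ne_zero (z : Omega F) {a : F[X]} (ha : a ≠ 0) (b : F[X]) :
    embA a * (z : CInf F) + embA b ≠ 0 := by
  rw [← norm_pos_iff]
  exact (mul_pos (norm_pos_iff.2 (embA_ne_zero ha)) (imAbs_pos z)).trans_le
    (norm_embA_mul_imAbs_le z a b)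

theorem norm_kappa_mul_imAbs_le_one (γ : GL (Fin 2) (RatFunc F)) (z : Omega F) :
    ‖kappa γ z‖ * imAbs z ≤ 1 := by
  rw [kappa, norm_div, div_mul_eq_mul_div]
  exact div_le_one_of_le₀ (norm_embK_mul_imAbs_le γ z) (norm_nonneg _)

/-- `|u z + v| ≥ |v| |z|_i / |z|` for `u, v ∈ K_∞`. -/
theorem norm_mul_imAbs_le' (z : Omega F) (u v : KInf F) :
    ‖v‖ * imAbs z ≤
      ‖algebraMap (KInf F) (CInf F) u * z + algebraMap (KInf F) (CInf F) v‖ * ‖(z : CInf F)‖ := by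
  set w := algebraMap (KInf F) (CInf F) u * z + algebraMap (KInf F) (CInf F) v with hw
  have h1 := norm_mul_imAbs_le z u v
  rw [← hw] at h1
  have h2 : ‖v‖ ≤ max ‖w‖ (‖u‖ * ‖(z : CInf F)‖) := by
    have : algebraMap (KInf F) (CInf F) v = w + -(algebraMap (KInf F) (CInf F) u * z) := by
      rw [hw]; ring
    rw [← norm_algebraMap' (CInf F) v, this]
    refine (IsUltrametricDist.norm_add_le_max _ _).trans ?_
    rw [norm_neg, norm_mul, norm_algebraMap']
  have h3 := imAbs_le_norm z
  have h4 := (imAbs_pos z).le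
  rcases le_max_iff.1 h2 with h | h
  · calc ‖v‖ * imAbs z ≤ ‖w‖ * imAbs z := by gcongr
      _ ≤ _ := by gcongr
  · calc ‖v‖ * imAbs z ≤ (‖u‖ * ‖(z : CInf F)‖) * imAbs z := by gcongr
      _ = ‖u‖ * imAbs z * ‖(z : CInf F)‖ := by ring
      _ ≤ _ := by gcongr

/-! ### The affinoids -/

theorem exists_mem_OmegaAff (z : Omega F) : ∃ n, z ∈ OmegaAff (F := F) n := by
  obtain ⟨n, hn⟩ := pow_unbounded_of_one_lt (max ‖(z : CInf F)‖ (imAbs z)⁻¹)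
    (one_lt_card (F := F))
  refine ⟨n, ((le_max_left _ _).trans hn.le), ?_⟩
  rw [inv_le_comm₀ (pow_pos card_pos n) (imAbs_pos z)]
  exact (le_max_right _ _).trans hn.le

/-! ### Fractional linear transformations -/

theorem coe_mob (γ : GL (Fin 2) (RatFunc F)) (z : Omega F) :
    ((mob γ z : Omega F) : CInf F) = (embK (γ 0 0) * (z : CInf F) + embK (γ 0 1)) / denom γ z := rfl

theorem denom_mul (γ δ : GL (Fin 2) (RatFunc F)) (z : Omega F) :
    denom (γ * δ) z = denom γ (mob δ z) * denom δ z := by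
  have h := denom_ne_zero δ z
  rw [denom, denom, coe_mob]
  simp only [Units.val_mul, Matrix.mul_apply, Fin.sum_univ_two, map_add, map_mul]
  field_simp
  rw [denom]
  ring

theorem mob_mul (γ δ : GL (Fin 2) (RatFunc F)) (z : Omega F) :
    mob (γ * δ) z = mob γ (mob δ z) := by
  apply Subtype.ext
  have h := denom_ne_zero δ z
  have h' := denom_ne_zero γ (mob δ z)
  rw [coe_mob, coe_mob, denom_mul, div_eq_div_iff (mul_ne_zero h' h) h', coe_mob]
  simp only [Units.val_mul, Matrix.mul_apply, Fin.sum_univ_two, map_add, map_mul]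
  field_simp
  rw [denom]
  ring

theorem denom_one (z : Omega F) : denom 1 z = 1 := by simp [denom]

theorem mob_one (z : Omega F) : mob 1 z = z := by
  apply Subtype.ext
  simp [coe_mob, denom_one]

/-- The determinant, as an element of `ℂ_∞`. -/
def detC (γ : GL (Fin 2) (RatFunc F)) : CInf F :=
  embK (γ : Matrix (Fin 2) (Fin 2) (RatFunc F)).det

theorem detC_eq (γ : GL (Fin 2) (RatFunc F)) :
    detC γ = embK (γ 0 0) * embK (γ 1 1) - embK (γ 0 1) * embK (γ 1 0) := by
  rw [detC, Matrix.det_fin_two]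
  simp

theorem detC_ne_zero (γ : GL (Fin 2) (RatFunc F)) : detC γ ≠ 0 := by
  rw [detC_eq]
  exact embK_det_ne_zero γ

theorem detC_mul (γ δ : GL (Fin 2) (RatFunc F)) : detC (γ * δ) = detC γ * detC δ := by
  simp [detC]

theorem detC_one : detC (1 : GL (Fin 2) (RatFunc F)) = 1 := by simp [detC]

theorem slash_apply (k m : ℤ) (f : Omega F → CInf F) (γ : GL (Fin 2) (RatFunc F)) (z : Omega F) :
    slash k m f γ z = detC γ ^ m * denom γ z ^ (-k) * f (mob γ z) := rfl

theorem slash_one (k m : ℤ) (f : Omega F → CInf F) : slash k m f 1 = f := by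
  ext z
  simp [slash_apply, detC_one, denom_one, mob_one]

theorem slash_mul_right (k m : ℤ) (f : Omega F → CInf F) (γ δ : GL (Fin 2) (RatFunc F)) :
    slash k m f (γ * δ) = slash k m (slash k m f γ) δ := by
  ext z
  simp only [slash_apply, detC_mul, denom_mul, mob_mul, mul_zpow]
  ring

theorem slash_mul (k m k' m' : ℤ) (f g : Omega F → CInf F) (γ : GL (Fin 2) (RatFunc F))
    (z : Omega F) :
    slash (k + k') (m + m') (fun w => f w * g w) γ z = slash k m f γ z * slash k' m' g γ z := by
  simp only [slash_apply]
  rw [neg_add, zpow_add₀ (detC_ne_zero γ), zpow_add₀ (denom_ne_zero γ z)]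
  ring

theorem slash_pow (k m : ℤ) (f : Omega F → CInf F) (n : ℕ) (γ : GL (Fin 2) (RatFunc F))
    (z : Omega F) :
    slash (n * k) (n * m) (fun w => f w ^ n) γ z = slash k m f γ z ^ n := by
  simp only [slash_apply, mul_pow]
  rw [← zpow_natCast (detC γ ^ m), ← zpow_natCast (denom γ z ^ (-k)), ← zpow_mul, ← zpow_mul,
    mul_comm m, neg_mul, mul_comm k]

theorem slash_mul_pow {k m k' m' : ℤ} (K M : ℤ) (f g : Omega F → CInf F) (n : ℕ)
    (hk : k = K - n * k') (hm : m = M - n * m')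
    (γ : GL (Fin 2) (RatFunc F)) (z : Omega F) :
    slash K M (fun w => f w * g w ^ n) γ z = slash k m f γ z * slash k' m' g γ z ^ n := by
  rw [← slash_pow, ← slash_mul k m, hk, hm]
  congr 1 <;> ring

theorem slash_const_mul (k m : ℤ) (c : CInf F) (f : Omega F → CInf F)
    (γ : GL (Fin 2) (RatFunc F)) (z : Omega F) :
    slash k m (fun w => c * f w) γ z = c * slash k m f γ z := by
  simp only [slash_apply]; ring

theorem slash_add (k m : ℤ) (f g : Omega F → CInf F) (γ : GL (Fin 2) (RatFunc F)) (z : Omega F) :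
    slash k m (fun w => f w + g w) γ z = slash k m f γ z + slash k m g γ z := by
  simp only [slash_apply]; ring

theorem slash_sum {ι : Type*} (s : Finset ι) (k m : ℤ) (f : ι → Omega F → CInf F)
    (γ : GL (Fin 2) (RatFunc F)) (z : Omega F) :
    slash k m (fun w => ∑ i ∈ s, f i w) γ z = ∑ i ∈ s, slash k m (f i) γ z := by
  simp only [slash_apply, Finset.mul_sum]

/-- $c/(cz+d)$ is the logarithmic derivative of $cz+d$, and $\det\delta/(\text{denom}\,\delta)^2$ is
the derivative of $z\mapsto\delta z$. The identity is the logarithmic derivative of `denom_mul`. -/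
theorem kappa_mul (γ δ : GL (Fin 2) (RatFunc F)) (z : Omega F) :
    kappa (γ * δ) z = slash 2 1 (kappa γ) δ z + kappa δ z := by
  have h := denom_ne_zero δ z
  have h' := denom_ne_zero γ (mob δ z)
  simp only [slash_apply, kappa, denom_mul, detC_eq]
  rw [zpow_neg, zpow_one]
  simp only [Units.val_mul, Matrix.mul_apply, Fin.sum_univ_two, map_add, map_mul]
  have e : denom γ (mob δ z) * denom δ z = embK (γ 1 0) * (embK (δ 0 0) * (z : CInf F) +
      embK (δ 0 1)) + embK (γ 1 1) * denom δ z := by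
    rw [denom, coe_mob]; field_simp
  have e2 : (denom δ z) ^ (2 : ℤ) = denom δ z ^ 2 := by norm_cast
  have e3 : denom δ z = embK (δ 1 0) * (z : CInf F) + embK (δ 1 1) := rfl
  rw [e2]
  field_simp
  linear_combination (-embK (δ 1 0)) * e + embK (γ 1 0) * embK (δ 0 0) * e3

/-! ### Rational functions without poles on a subset of `Ω` -/

/-- `g` is given on `S` by a rational function without poles in `S`. -/
def IsRatOn (S : Set (Omega F)) (g : Omega F → CInf F) : Prop :=
  ∃ P Q : (CInf F)[X], (∀ z ∈ S, Q.eval (z : CInf F) ≠ 0) ∧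
    ∀ z ∈ S, g z = P.eval (z : CInf F) / Q.eval (z : CInf F)

namespace IsRatOn

variable {S : Set (Omega F)} {f g : Omega F → CInf F}

theorem of_eval (P : (CInf F)[X]) : IsRatOn S (fun z => P.eval (z : CInf F)) :=
  ⟨P, 1, by simp, by simp⟩

theorem const (c : CInf F) : IsRatOn S (fun _ => c) := by
  simpa using of_eval (S := S) (C c)

theorem coe : IsRatOn S (fun z => (z : CInf F)) := by
  simpa using of_eval (S := S) X

theorem add (hf : IsRatOn S f) (hg : IsRatOn S g) : IsRatOn S (fun z => f z + g z) := by
  obtain ⟨P, Q, hQ, h⟩ := hf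
  obtain ⟨P', Q', hQ', h'⟩ := hg
  refine ⟨P * Q' + Q * P', Q * Q', fun z hz => ?_, fun z hz => ?_⟩
  · rw [eval_mul]
    exact mul_ne_zero (hQ z hz) (hQ' z hz)
  · beta_reduce
    rw [h z hz, h' z hz, div_add_div _ _ (hQ z hz) (hQ' z hz)]
    simp

theorem mul (hf : IsRatOn S f) (hg : IsRatOn S g) : IsRatOn S (fun z => f z * g z) := by
  obtain ⟨P, Q, hQ, h⟩ := hf
  obtain ⟨P', Q', hQ', h'⟩ := hg
  refine ⟨P * P', Q * Q', fun z hz => ?_, fun z hz => ?_⟩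
  · rw [eval_mul]
    exact mul_ne_zero (hQ z hz) (hQ' z hz)
  · beta_reduce
    rw [h z hz, h' z hz, div_mul_div_comm]
    simp

theorem inv (hf : IsRatOn S f) (h0 : ∀ z ∈ S, f z ≠ 0) : IsRatOn S (fun z => (f z)⁻¹) := by
  obtain ⟨P, Q, hQ, h⟩ := hf
  refine ⟨Q, P, fun z hz hP => h0 z hz ?_, fun z hz => ?_⟩
  · rw [h z hz, hP, zero_div]
  · beta_reduce
    rw [h z hz, inv_div]

theorem pow (hf : IsRatOn S f) (n : ℕ) : IsRatOn S (fun z => f z ^ n) := by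
  induction n with
  | zero => simpa using const (S := S) 1
  | succ n ih => simpa only [pow_succ] using ih.mul hf

theorem zpow (hf : IsRatOn S f) (h0 : ∀ z ∈ S, f z ≠ 0) (n : ℤ) :
    IsRatOn S (fun z => f z ^ n) := by
  cases n with
  | ofNat n => simpa using hf.pow n
  | negSucc n =>
    simpa using (hf.pow (n + 1)).inv fun z hz => pow_ne_zero _ (h0 z hz)

theorem sum {ι : Type*} (s : Finset ι) (f : ι → Omega F → CInf F)
    (hf : ∀ i ∈ s, IsRatOn S (f i)) : IsRatOn S (fun z => ∑ i ∈ s, f i z) := by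
  classical
  induction s using Finset.induction_on with
  | empty => simpa using const (S := S) 0
  | insert i s hi ih =>
    simp only [Finset.sum_insert hi]
    exact (hf i (Finset.mem_insert_self i s)).add
      (ih fun j hj => hf j (Finset.mem_insert_of_mem hj))

theorem eval (hf : IsRatOn S f) (P : (CInf F)[X]) : IsRatOn S (fun z => P.eval (f z)) := by
  simp only [eval_eq_sum_range]
  exact sum _ _ fun i _ => (const _).mul (hf.pow i)

theorem comp {T : Set (Omega F)} {φ : Omega F → Omega F} (hg : IsRatOn T g)
    (hφ : IsRatOn S fun z => (φ z : CInf F)) (h : Set.MapsTo φ S T) :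
    IsRatOn S (fun z => g (φ z)) := by
  obtain ⟨P, Q, hQ, hPQ⟩ := hg
  obtain ⟨P', Q', hQ', h'⟩ := ((hφ.eval P).mul ((hφ.eval Q).inv fun z hz => hQ _ (h hz)))
  exact ⟨P', Q', hQ', fun z hz => by
    rw [← h' z hz]
    exact (hPQ _ (h hz)).trans (div_eq_mul_inv _ _)⟩

theorem denom (γ : GL (Fin 2) (RatFunc F)) : IsRatOn S (denom γ) :=
  ((const _).mul coe).add (const _)

theorem coe_mob (γ : GL (Fin 2) (RatFunc F)) : IsRatOn S (fun z => (mob γ z : CInf F)) := by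
  simp only [DrinfeldQM.coe_mob, div_eq_mul_inv]
  exact (((const _).mul coe).add (const _)).mul ((denom γ).inv fun z _ => denom_ne_zero γ z)

theorem kappa (γ : GL (Fin 2) (RatFunc F)) : IsRatOn S (kappa γ) := by
  unfold DrinfeldQM.kappa
  simp only [div_eq_mul_inv]
  exact (const _).mul ((denom γ).inv fun z _ => denom_ne_zero γ z)

end IsRatOn

/-! ### Boundedness of rational functions on the affinoids -/

/-- A point $s\in\mathbb C_\infty$ outside $\Omega_n$ either has $|s|>q^n$, so $|z-s|=|s|$, or lies
within less than $q^{-n}$ of some $x\in K_\infty$, so $|z-s|=|z-x|\ge q^{-n}$. If $r\notin\mathbb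
C_\infty$, completeness makes $\mathbb C_\infty$ closed in $L$. The extension $L$ will be a
splitting field. -/
theorem exists_le_norm_sub_of_notMem {L : Type*} [NormedField L] [NormedAlgebra (CInf F) L] (n : ℕ)
    (r : L) (hr : ∀ z ∈ OmegaAff (F := F) n, algebraMap (CInf F) L z ≠ r) :
    ∃ c : ℝ, 0 < c ∧ ∀ z ∈ OmegaAff (F := F) n, c ≤ ‖algebraMap (CInf F) L z - r‖ := by
  set B : ℝ := (Fintype.card F : ℝ) ^ n with hB
  have hBpos : 0 < B := pow_pos card_pos n
  have key : ∀ x : KInf F, ∀ z ∈ OmegaAff (F := F) n,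
      B⁻¹ ≤ ‖(z : CInf F) - algebraMap (KInf F) (CInf F) x‖ :=
    fun x z hz => hz.2.trans (imAbs_le z x)
  by_cases hmem : r ∈ Set.range (algebraMap (CInf F) L)
  · obtain ⟨s, rfl⟩ := hmem
    simp only [← map_sub, norm_algebraMap']
    by_cases hs : ‖s‖ ≤ B
    · have hsx : ∃ x : KInf F, ‖s - algebraMap (KInf F) (CInf F) x‖ < B⁻¹ := by
        by_cases hsK : s ∈ Set.range (algebraMap (KInf F) (CInf F))
        · obtain ⟨x, rfl⟩ := hsK
          exact ⟨x, by simpa using hBpos⟩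
        · by_contra! hcon
          refine hr ⟨s, hsK⟩ ⟨hs, ?_⟩ rfl
          refine (Metric.le_infDist (Set.range_nonempty _)).2 ?_
          rintro _ ⟨x, rfl⟩
          rw [dist_eq_norm]
          exact hcon x
      obtain ⟨x, hx⟩ := hsx
      refine ⟨B⁻¹, inv_pos.2 hBpos, fun z hz => ?_⟩
      have h1 := key x z hz
      have h2 : (z : CInf F) - s = (algebraMap (KInf F) (CInf F) x - s) +
          (z - algebraMap (KInf F) (CInf F) x) := by ring
      rw [h2, norm_add_eq_right]
      · exact h1
      · rw [norm_sub_rev]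
        exact hx.trans_le h1
    · push Not at hs
      refine ⟨‖s‖, hBpos.trans hs, fun z hz => ?_⟩
      rw [sub_eq_add_neg, norm_add_eq_right, norm_neg]
      rw [norm_neg]
      exact hz.1.trans_lt hs
  · have hcl : IsClosed (Set.range (algebraMap (CInf F) L)) :=
      (algebraMap_isometry (CInf F) L).isClosedEmbedding.isClosed_range
    refine ⟨_, (hcl.notMem_iff_infDist_pos ⟨_, 0, rfl⟩).1 hmem, fun z _ => ?_⟩
    rw [norm_sub_rev, ← dist_eq_norm]
    exact Metric.infDist_le_dist_of_mem ⟨_, rfl⟩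

theorem exists_norm_gt_one_CInf : ∃ x : CInf F, 1 < ‖x‖ :=
  ⟨embA X, by rw [norm_embA X_ne_zero, natDegree_X, pow_one]; exact one_lt_card⟩

/-- Split $Q$ in an extension normed by the spectral norm. No root is a point of $\Omega_n$, so each
linear factor is bounded below there. -/
theorem exists_le_norm_eval (n : ℕ) (Q : (CInf F)[X])
    (hQ : ∀ z ∈ OmegaAff (F := F) n, Q.eval (z : CInf F) ≠ 0) :
    ∃ c : ℝ, 0 < c ∧ ∀ z ∈ OmegaAff (F := F) n, c ≤ ‖Q.eval (z : CInf F)‖ := by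
  rcases eq_or_ne Q 0 with rfl | hQ0
  · exact ⟨1, one_pos, fun z hz => absurd eval_zero (hQ z hz)⟩
  let _ : NontriviallyNormedField (CInf F) :=
    { (inferInstance : NormedField (CInf F)) with non_trivial := exists_norm_gt_one_CInf }
  let L := Q.SplittingField
  let _ : NormedField L := spectralNorm.normedField (CInf F) L
  let _ : NormedAlgebra (CInf F) L := spectralNorm.normedAlgebra (CInf F) L
  have hs := SplittingField.splits Q
  have hev : ∀ z : CInf F, algebraMap (CInf F) L (Q.eval z) =
      algebraMap (CInf F) L Q.leadingCoeff *
        ((Q.map (algebraMap (CInf F) L)).roots.map fun r => algebraMap (CInf F) L z - r).prod := by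
    intro z
    have h := hs.eval_eq_prod_roots (algebraMap (CInf F) L z)
    rwa [eval_map_algebraMap, aeval_algebraMap_apply_eq_algebraMap_eval, leadingCoeff_map] at h
  have hprod : ∀ s : Multiset L,
      (∀ r ∈ s, ∀ z ∈ OmegaAff (F := F) n, algebraMap (CInf F) L z ≠ r) →
      ∃ c : ℝ, 0 < c ∧ ∀ z ∈ OmegaAff (F := F) n,
        c ≤ ‖(s.map fun r => algebraMap (CInf F) L z - r).prod‖ := by
    intro s
    induction s using Multiset.induction_on with
    | empty => exact fun _ => ⟨1, one_pos, by simp⟩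
    | cons r s ih =>
      intro h
      obtain ⟨c, hc, hc'⟩ := ih fun r hr => h r (Multiset.mem_cons_of_mem hr)
      obtain ⟨d, hd, hd'⟩ := exists_le_norm_sub_of_notMem n r (h r (Multiset.mem_cons_self r s))
      refine ⟨d * c, mul_pos hd hc, fun z hz => ?_⟩
      rw [Multiset.map_cons, Multiset.prod_cons, norm_mul]
      exact mul_le_mul (hd' z hz) (hc' z hz) hc.le (norm_nonneg _)
  obtain ⟨c, hc, hc'⟩ := hprod (Q.map (algebraMap (CInf F) L)).roots (by
    rintro r hr z hz rfl
    have h := (mem_roots'.1 hr).2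
    rw [IsRoot.def, eval_map_algebraMap, aeval_algebraMap_apply_eq_algebraMap_eval] at h
    exact hQ z hz ((map_eq_zero _).1 h))
  refine ⟨‖Q.leadingCoeff‖ * c, mul_pos (norm_pos_iff.2 (leadingCoeff_ne_zero.2 hQ0)) hc,
    fun z hz => ?_⟩
  rw [← norm_algebraMap' L (Q.eval (z : CInf F)), hev, norm_mul, norm_algebraMap']
  gcongr
  exact hc' z hz

/-- $\Omega_n$ is not compact, so this rests on the lower bound for the denominator. It is what
makes products of uniform limits uniform limits. -/
theorem IsRatOn.bounded {n : ℕ} {g : Omega F → CInf F} (hg : IsRatOn (OmegaAff (F := F) n) g) :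
    ∃ B : ℝ, 0 < B ∧ ∀ z ∈ OmegaAff (F := F) n, ‖g z‖ ≤ B := by
  obtain ⟨P, Q, hQ, h⟩ := hg
  obtain ⟨c, hc, hcQ⟩ := exists_le_norm_eval n Q hQ
  set M : ℝ := ∑ i ∈ Finset.range (P.natDegree + 1),
    ‖P.coeff i‖ * ((Fintype.card F : ℝ) ^ n) ^ i with hM
  have hM0 : 0 ≤ M := Finset.sum_nonneg fun i _ => by positivity
  refine ⟨(M + 1) / c, by positivity, fun z hz => ?_⟩
  rw [h z hz, norm_div]
  gcongr
  · rw [eval_eq_sum_range]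
    refine (norm_sum_le _ _).trans ((Finset.sum_le_sum fun i _ => ?_).trans
      (le_add_of_nonneg_right zero_le_one))
    rw [norm_mul, norm_pow]
    gcongr
    exact hz.1
  · exact hcQ z hz

/-- For $x\in K_\infty$, $\gamma z-x=(uz+v)/(cz+d)$ with $u=a-xc$, $v=b-xd$. Since
$ud-vc=\det\gamma$, the numbers $u$ and $v$ are not both small, and each is bounded by a constant
times $|uz+v|$. This bounds $|\gamma z-x|$ below uniformly in $x$. -/
theorem exists_mapsTo_OmegaAff (γ : GL (Fin 2) (RatFunc F)) (n : ℕ) :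
    ∃ n', Set.MapsTo (mob γ) (OmegaAff (F := F) n) (OmegaAff n') := by
  obtain ⟨B, hB, hB'⟩ := (IsRatOn.coe_mob (S := OmegaAff (F := F) n) γ).bounded
  obtain ⟨D, hD, hD'⟩ := (IsRatOn.denom (S := OmegaAff (F := F) n) γ).bounded
  set Q : ℝ := (Fintype.card F : ℝ) ^ n with hQ
  have hQpos : 0 < Q := pow_pos card_pos n
  set c := algebraMap (RatFunc F) (KInf F) (γ 1 0) with hc
  set d := algebraMap (RatFunc F) (KInf F) (γ 1 1) with hd
  set a := algebraMap (RatFunc F) (KInf F) (γ 0 0) with ha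
  set b := algebraMap (RatFunc F) (KInf F) (γ 0 1) with hb
  set M : ℝ := Q * ‖d‖ + Q * Q * ‖c‖ + 1 with hM
  have hMpos : 0 < M := by positivity
  have hdet : 0 < ‖detC γ‖ := norm_pos_iff.2 (detC_ne_zero γ)
  have key : ∀ z ∈ OmegaAff (F := F) n, ‖detC γ‖ / (M * D) ≤ imAbs (mob γ z) := by
    intro z hz
    refine (Metric.le_infDist (Set.range_nonempty _)).2 ?_
    rintro _ ⟨x, rfl⟩
    rw [dist_eq_norm]
    set w := algebraMap (KInf F) (CInf F) (a - x * c) * z + algebraMap (KInf F) (CInf F) (b - x * d)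
      with hw
    have hden := denom_ne_zero γ z
    have e : (mob γ z : CInf F) - algebraMap (KInf F) (CInf F) x = w / denom γ z := by
      rw [coe_mob, eq_div_iff hden, sub_mul, div_mul_cancel₀ _ hden, hw]
      simp only [map_sub, map_mul, denom, embK, RingHom.comp_apply, ha, hb, hc, hd]
      ring
    rw [e, norm_div]
    have him : Q⁻¹ ≤ imAbs z := hz.2
    have hu : ‖a - x * c‖ ≤ Q * ‖w‖ := by
      have h := norm_mul_imAbs_le z (a - x * c) (b - x * d)
      rw [← hw] at h
      rw [← inv_mul_le_iff₀ hQpos, mul_comm]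
      exact le_trans (by gcongr) h
    have hv : ‖b - x * d‖ ≤ Q * Q * ‖w‖ := by
      have h := norm_mul_imAbs_le' z (a - x * c) (b - x * d)
      rw [← hw] at h
      have h2 : ‖b - x * d‖ * Q⁻¹ ≤ ‖w‖ * Q :=
        le_trans (by gcongr) (h.trans (by gcongr; exact hz.1))
      rw [mul_inv_le_iff₀ hQpos] at h2
      linarith
    have hdw : ‖detC γ‖ ≤ M * ‖w‖ := by
      have h : detC γ = algebraMap (KInf F) (CInf F) ((a - x * c) * d - (b - x * d) * c) := by
        rw [detC_eq]
        simp only [map_sub, map_mul, embK, RingHom.comp_apply, ha, hb, hc, hd]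
        ring
      rw [h, norm_algebraMap']
      refine (norm_sub_le _ _).trans ?_
      rw [norm_mul, norm_mul]
      calc ‖a - x * c‖ * ‖d‖ + ‖b - x * d‖ * ‖c‖
          ≤ Q * ‖w‖ * ‖d‖ + Q * Q * ‖w‖ * ‖c‖ := by gcongr
        _ ≤ M * ‖w‖ := by rw [hM]; nlinarith [norm_nonneg w]
    calc ‖detC γ‖ / (M * D) ≤ M * ‖w‖ / (M * D) := by gcongr
      _ = ‖w‖ / D := by field_simp
      _ ≤ ‖w‖ / ‖denom γ z‖ := by
        gcongr
        exact hD' z hz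
  have hpos : 0 < ‖detC γ‖ / (M * D) := by positivity
  obtain ⟨n', hn'⟩ := pow_unbounded_of_one_lt (max B (‖detC γ‖ / (M * D))⁻¹) (one_lt_card (F := F))
  refine ⟨n', fun z hz => ⟨(hB' z hz).trans ((le_max_left _ _).trans hn'.le), ?_⟩⟩
  refine le_trans ?_ (key z hz)
  rw [inv_le_comm₀ (pow_pos card_pos _) hpos]
  exact (le_max_right _ _).trans hn'.le

/-! ### Rigid analytic functions -/

theorem IsRigidAnalytic.of_approx {f : Omega F → CInf F}
    (h : ∀ n : ℕ, ∀ ε : ℝ, 0 < ε → ∃ g, IsRatOn (OmegaAff (F := F) n) g ∧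
      ∀ z ∈ OmegaAff (F := F) n, ‖f z - g z‖ ≤ ε) : IsRigidAnalytic f := by
  intro n ε hε
  obtain ⟨g, ⟨P, Q, hQ, hPQ⟩, hg⟩ := h n ε hε
  exact ⟨P, Q, hQ, fun z hz => by rw [← hPQ z hz]; exact hg z hz⟩

theorem IsRatOn.isRigidAnalytic {f : Omega F → CInf F}
    (h : ∀ n, IsRatOn (OmegaAff (F := F) n) f) : IsRigidAnalytic f :=
  .of_approx fun n ε hε => ⟨f, h n, fun z _ => by simpa using hε.le⟩

namespace IsRigidAnalytic

variable {f g : Omega F → CInf F}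

theorem approx (hf : IsRigidAnalytic f) (n : ℕ) {ε : ℝ} (hε : 0 < ε) :
    ∃ g, IsRatOn (OmegaAff (F := F) n) g ∧ ∀ z ∈ OmegaAff (F := F) n, ‖f z - g z‖ ≤ ε := by
  obtain ⟨P, Q, hQ, h⟩ := hf n ε hε
  exact ⟨fun z => P.eval (z : CInf F) / Q.eval (z : CInf F), ⟨P, Q, hQ, fun _ _ => rfl⟩, h⟩

theorem const (c : CInf F) : IsRigidAnalytic (fun _ : Omega F => c) :=
  IsRatOn.isRigidAnalytic fun _ => .const c

theorem bounded (hf : IsRigidAnalytic f) (n : ℕ) :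
    ∃ B : ℝ, 0 < B ∧ ∀ z ∈ OmegaAff (F := F) n, ‖f z‖ ≤ B := by
  obtain ⟨g, hg, h⟩ := hf.approx n one_pos
  obtain ⟨B, hB, hB'⟩ := hg.bounded
  refine ⟨1 + B, by positivity, fun z hz => ?_⟩
  calc ‖f z‖ = ‖(f z - g z) + g z‖ := by rw [sub_add_cancel]
    _ ≤ 1 + B := (norm_add_le _ _).trans (add_le_add (h z hz) (hB' z hz))

theorem add (hf : IsRigidAnalytic f) (hg : IsRigidAnalytic g) :
    IsRigidAnalytic (fun z => f z + g z) := by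
  refine .of_approx fun n ε hε => ?_
  obtain ⟨p, hp, hp'⟩ := hf.approx n hε
  obtain ⟨r, hr, hr'⟩ := hg.approx n hε
  refine ⟨_, hp.add hr, fun z hz => ?_⟩
  rw [add_sub_add_comm]
  exact (IsUltrametricDist.norm_add_le_max _ _).trans (max_le (hp' z hz) (hr' z hz))

theorem mul (hf : IsRigidAnalytic f) (hg : IsRigidAnalytic g) :
    IsRigidAnalytic (fun z => f z * g z) := by
  refine .of_approx fun n ε hε => ?_
  obtain ⟨B, hB, hB'⟩ := hg.bounded n
  obtain ⟨p, hp, hp'⟩ := hf.approx n (div_pos hε hB)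
  obtain ⟨D, hD, hD'⟩ := hp.bounded
  obtain ⟨r, hr, hr'⟩ := hg.approx n (div_pos hε hD)
  refine ⟨_, hp.mul hr, fun z hz => ?_⟩
  have e : f z * g z - p z * r z = (f z - p z) * g z + p z * (g z - r z) := by ring
  rw [e]
  refine (IsUltrametricDist.norm_add_le_max _ _).trans (max_le ?_ ?_)
  · rw [norm_mul, ← div_mul_cancel₀ ε hB.ne']
    exact mul_le_mul (hp' z hz) (hB' z hz) (norm_nonneg _) (by positivity)
  · rw [norm_mul, show ε = D * (ε / D) by field_simp]
    exact mul_le_mul (hD' z hz) (hr' z hz) (norm_nonneg _) (by positivity)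

theorem const_mul (c : CInf F) (hf : IsRigidAnalytic f) : IsRigidAnalytic (fun z => c * f z) :=
  (const c).mul hf

theorem sub (hf : IsRigidAnalytic f) (hg : IsRigidAnalytic g) :
    IsRigidAnalytic (fun z => f z - g z) := by
  simpa [sub_eq_add_neg] using hf.add (hg.const_mul (-1))

theorem pow (hf : IsRigidAnalytic f) (n : ℕ) : IsRigidAnalytic (fun z => f z ^ n) := by
  induction n with
  | zero => simpa using const (F := F) 1
  | succ n ih => simpa only [pow_succ] using ih.mul hf

theorem sum {ι : Type*} (s : Finset ι) (f : ι → Omega F → CInf F)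
    (hf : ∀ i ∈ s, IsRigidAnalytic (f i)) : IsRigidAnalytic (fun z => ∑ i ∈ s, f i z) := by
  classical
  induction s using Finset.induction_on with
  | empty => simpa using const (F := F) 0
  | insert i s hi ih =>
    simp only [Finset.sum_insert hi]
    exact (hf i (Finset.mem_insert_self i s)).add
      (ih fun j hj => hf j (Finset.mem_insert_of_mem hj))

theorem comp_mob (hf : IsRigidAnalytic f) (γ : GL (Fin 2) (RatFunc F)) :
    IsRigidAnalytic (fun z => f (mob γ z)) := by
  refine .of_approx fun n ε hε => ?_
  obtain ⟨n', hn'⟩ := exists_mapsTo_OmegaAff γ n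
  obtain ⟨p, hp, hp'⟩ := hf.approx n' hε
  exact ⟨_, hp.comp (.coe_mob γ) hn', fun z hz => hp' _ (hn' hz)⟩

theorem slash (hf : IsRigidAnalytic f) (k m : ℤ) (γ : GL (Fin 2) (RatFunc F)) :
    IsRigidAnalytic (slash k m f γ) :=
  (IsRatOn.isRigidAnalytic fun _ => (IsRatOn.const _).mul
    ((IsRatOn.denom γ).zpow (fun z _ => denom_ne_zero γ z) _)).mul (hf.comp_mob γ)

theorem kappa (γ : GL (Fin 2) (RatFunc F)) : IsRigidAnalytic (kappa γ) :=
  IsRatOn.isRigidAnalytic fun _ => .kappa γ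

end IsRigidAnalytic

theorem norm_sub_le_max (x y : CInf F) : ‖x - y‖ ≤ max ‖x‖ ‖y‖ := by
  rw [sub_eq_add_neg, ← norm_neg y]
  exact IsUltrametricDist.norm_add_le_max _ _

/-! ### Sums over polynomials of bounded degree -/

theorem finite_coeff_eq_zero (F : Type*) [Field F] [Fintype F] (N : ℕ) :
    {p : F[X] | ∀ m, N ≤ m → p.coeff m = 0}.Finite := by
  have : Finite (degreeLT F N) := Finite.of_equiv _ (degreeLTEquiv F N).toEquiv.symm
  refine (Set.toFinite (degreeLT F N : Set F[X])).subset fun p hp => ?_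
  rw [SetLike.mem_coe, mem_degreeLT, degree_lt_iff_coeff_zero]
  exact fun m hm => hp m hm

variable (F) in
/-- The polynomials of degree less than `N`. -/
def degBall (N : ℕ) : Finset F[X] := (finite_coeff_eq_zero F N).toFinset

theorem mem_degBall {N : ℕ} {p : F[X]} : p ∈ degBall F N ↔ ∀ m, N ≤ m → p.coeff m = 0 := by
  simp [degBall]

theorem natDegree_of_notMem_degBall {N : ℕ} {p : F[X]} (h : p ∉ degBall F N) :
    p ≠ 0 ∧ N ≤ p.natDegree := by
  rw [mem_degBall] at h
  push Not at h
  obtain ⟨m, hm, hp⟩ := h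
  exact ⟨fun h0 => hp (by simp [h0]), hm.trans (le_natDegree_of_ne_zero hp)⟩

theorem norm_embA_of_notMem_degBall {N : ℕ} {p : F[X]} (h : p ∉ degBall F N) :
    (Fintype.card F : ℝ) ^ N ≤ ‖(embA p : CInf F)‖ := by
  obtain ⟨h0, hN⟩ := natDegree_of_notMem_degBall h
  rw [norm_embA h0]
  exact pow_le_pow_right₀ one_lt_card.le hN

theorem zero_mem_degBall (N : ℕ) : (0 : F[X]) ∈ degBall F N := by
  simp [mem_degBall]

theorem C_mul_mem_degBall {N : ℕ} {p : F[X]} (c : F) (h : p ∈ degBall F N) :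
    C c * p ∈ degBall F N := by
  rw [mem_degBall] at h ⊢
  intro m hm
  rw [coeff_C_mul, h m hm, mul_zero]

/-- Isolating the constant term exposes an inner sum over the finite field, where the cancellation
takes place. -/
theorem sum_degBall_succ {M : Type*} [AddCommMonoid M] (N : ℕ) (g : F[X] → M) :
    ∑ b ∈ degBall F (N + 1), g b = ∑ b ∈ degBall F N, ∑ c : F, g (X * b + C c) := by
  rw [← Finset.sum_product']
  refine Finset.sum_bij' (fun p _ => (divX p, p.coeff 0)) (fun x _ => X * x.1 + C x.2)
    ?_ ?_ ?_ ?_ ?_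
  · intro p hp
    rw [Finset.mem_product, mem_degBall]
    rw [mem_degBall] at hp
    refine ⟨fun m hm => ?_, Finset.mem_univ _⟩
    rw [coeff_divX]
    exact hp _ (by omega)
  · rintro ⟨b, c⟩ hb
    rw [Finset.mem_product, mem_degBall] at hb
    rw [mem_degBall]
    intro m hm
    obtain ⟨m, rfl⟩ : ∃ m', m = m' + 1 := ⟨m - 1, by omega⟩
    rw [coeff_add, coeff_X_mul, coeff_C_succ, add_zero]
    exact hb.1 m (by omega)
  · exact fun p _ => X_mul_divX_add p
  · rintro ⟨b, c⟩ _
    ext <;> simp [divX_add, coeff_divX]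
  · intro p _
    rw [X_mul_divX_add]

theorem sum_degBall_const {N : ℕ} (hN : 1 ≤ N) (x : CInf F) :
    ∑ _b ∈ degBall F N, x = 0 := by
  obtain ⟨N, rfl⟩ : ∃ N', N = N' + 1 := ⟨N - 1, by omega⟩
  rw [sum_degBall_succ]
  refine Finset.sum_eq_zero fun b _ => ?_
  rw [Finset.sum_const, Finset.card_univ, nsmul_eq_mul, card_cast_eq_zero, zero_mul]

open Classical in
variable (F) in
/-- The monic polynomials of degree less than `N`. -/
def monBall (N : ℕ) : Finset {a : F[X] // a.Monic} := (degBall F N).subtype _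

theorem mem_monBall {N : ℕ} {a : {a : F[X] // a.Monic}} : a ∈ monBall F N ↔ a.1 ∈ degBall F N := by
  simp [monBall]

theorem card_units_cast [Fintype Fˣ] : ((Fintype.card Fˣ : ℕ) : CInf F) = -1 := by
  have h : Fintype.card Fˣ + 1 = Fintype.card F := by
    rw [← Nat.card_eq_fintype_card, ← Nat.card_eq_fintype_card, Nat.card_units,
      Nat.card_eq_fintype_card]
    have := Fintype.card_pos (α := F)
    omega
  have h2 := card_cast_eq_zero (F := F)
  rw [← h, Nat.cast_add, Nat.cast_one] at h2
  exact eq_neg_of_add_eq_zero_left h2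

/-- Each nonzero polynomial is uniquely a unit times a monic one, and there are $q-1=-1$ units. This
turns the sum over monic $a$ into one over all $a$, where $a$ and $b$ play symmetric roles. -/
theorem sum_degBall_eq_neg_sum_monBall (N : ℕ) (g : F[X] → CInf F) (h0 : g 0 = 0)
    (hg : ∀ c : F, c ≠ 0 → ∀ a, g (C c * a) = g a) :
    ∑ a ∈ degBall F N, g a = -∑ a ∈ monBall F N, g a.1 := by
  classical
  rw [← Finset.sum_erase _ h0]
  have h : ∑ x ∈ (Finset.univ : Finset Fˣ) ×ˢ monBall F N, g x.2.1 =
      ∑ a ∈ (degBall F N).erase 0, g a := by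
    refine Finset.sum_bij (fun x _ => C (x.1 : F) * x.2.1) ?_ ?_ ?_ ?_
    · rintro ⟨c, a⟩ hx
      rw [Finset.mem_product, mem_monBall] at hx
      exact Finset.mem_erase.2 ⟨mul_ne_zero (C_ne_zero.2 c.ne_zero) a.2.ne_zero,
        C_mul_mem_degBall _ hx.2⟩
    · rintro ⟨c, a⟩ _ ⟨c', a'⟩ _ h
      have hl := congrArg leadingCoeff h
      simp only [leadingCoeff_mul, leadingCoeff_C, a.2.leadingCoeff, a'.2.leadingCoeff,
        mul_one] at hl
      have hc : c = c' := Units.ext hl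
      subst hc
      have ha : a = a' := Subtype.ext (mul_left_cancel₀ (C_ne_zero.2 c.ne_zero) h)
      rw [ha]
    · intro p hp
      obtain ⟨hp0, hp⟩ := Finset.mem_erase.1 hp
      have hl := leadingCoeff_ne_zero.2 hp0
      refine ⟨(Units.mk0 _ hl, ⟨p * C p.leadingCoeff⁻¹, monic_mul_leadingCoeff_inv hp0⟩), ?_, ?_⟩
      · rw [Finset.mem_product, mem_monBall]
        refine ⟨Finset.mem_univ _, ?_⟩
        simp only [mul_comm p]
        exact C_mul_mem_degBall _ hp
      · simp only [Units.val_mk0]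
        rw [mul_comm p, ← mul_assoc, ← C_mul, mul_inv_cancel₀ hl, C_1, one_mul]
    · rintro ⟨c, a⟩ _
      exact (hg _ c.ne_zero _).symm
  rw [← h, Finset.sum_product]
  simp only [Finset.sum_const, Finset.card_univ, nsmul_eq_mul]
  rw [card_units_cast, neg_one_mul]

/-! ### The lattice sums defining `E` -/

/-- `∑_b a / (a z + b)`, the sum being over the polynomials `b` of degree less than `N`. -/
def latticeSum (N : ℕ) (a : F[X]) (z : CInf F) : CInf F :=
  ∑ b ∈ degBall F N, embA a / (embA a * z + embA b)

/-- `∑_b a / (a z + b)`, the sum being over all `b ∈ A`. -/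
def latticeTsum (a : F[X]) (z : CInf F) : CInf F :=
  ∑' b : F[X], embA a / (embA a * z + embA b)

theorem norm_term_le (z : Omega F) {a : F[X]} (ha : a ≠ 0) (b : F[X]) :
    ‖embA a / (embA a * (z : CInf F) + embA b)‖ ≤ (imAbs z)⁻¹ := by
  have h := norm_embA_mul_imAbs_le z a b
  have hz := imAbs_pos z
  have ha' := norm_pos_iff.2 (embA_ne_zero ha)
  rw [norm_div, div_le_iff₀ (norm_pos_iff.2 (embA_mul_add_ne_zero z ha b)), ← div_eq_inv_mul,
    le_div_iff₀ hz]
  exact h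

theorem norm_term_le_of_notMem (z : Omega F) (a : F[X]) {b : F[X]} {N : ℕ}
    (hb : b ∉ degBall F N) (hN : ‖(embA a : CInf F)‖ * ‖(z : CInf F)‖ < (Fintype.card F : ℝ) ^ N) :
    ‖embA a / (embA a * (z : CInf F) + embA b)‖ ≤ ‖(embA a : CInf F)‖ / (Fintype.card F : ℝ) ^ N := by
  have h := norm_embA_of_notMem_degBall hb
  have h' : ‖embA a * (z : CInf F)‖ < ‖(embA b : CInf F)‖ := by
    rw [norm_mul]
    exact hN.trans_le h
  rw [norm_div, norm_add_eq_right h']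
  have := pow_pos (card_pos (F := F)) N
  gcongr

theorem exists_lt_card_pow (x : ℝ) : ∃ N : ℕ, x < (Fintype.card F : ℝ) ^ N :=
  pow_unbounded_of_one_lt x one_lt_card

theorem exists_div_card_pow_lt (x : ℝ) {ε : ℝ} (hε : 0 < ε) :
    ∃ N₀ : ℕ, ∀ N ≥ N₀, x / (Fintype.card F : ℝ) ^ N < ε := by
  obtain ⟨N₀, h⟩ := exists_lt_card_pow (F := F) (x / ε)
  refine ⟨N₀, fun N hN => ?_⟩
  rw [div_lt_iff₀ (pow_pos card_pos N), mul_comm, ← div_lt_iff₀ hε]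
  exact h.trans_le (pow_le_pow_right₀ one_lt_card.le hN)

theorem summable_term (z : Omega F) (a : F[X]) :
    Summable fun b : F[X] => embA a / (embA a * (z : CInf F) + embA b) := by
  apply NonarchimedeanAddGroup.summable_of_tendsto_cofinite_zero
  rw [NormedAddGroup.tendsto_nhds_zero]
  intro ε hε
  obtain ⟨N₁, h₁⟩ := exists_lt_card_pow (F := F) (‖(embA a : CInf F)‖ * ‖(z : CInf F)‖)
  obtain ⟨N₂, h₂⟩ := exists_div_card_pow_lt (F := F) ‖(embA a : CInf F)‖ hε
  rw [Filter.eventually_cofinite]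
  refine (degBall F (max N₁ N₂)).finite_toSet.subset fun b hb => ?_
  by_contra hb'
  refine hb ((norm_term_le_of_notMem z a hb' ?_).trans_lt (h₂ _ (le_max_right _ _)))
  exact h₁.trans_le (pow_le_pow_right₀ one_lt_card.le (le_max_left _ _))

theorem norm_latticeTsum_sub_le (z : Omega F) (a : F[X]) {N : ℕ}
    (hN : ‖(embA a : CInf F)‖ * ‖(z : CInf F)‖ < (Fintype.card F : ℝ) ^ N) :
    ‖latticeTsum a (z : CInf F) - latticeSum N a z‖ ≤
      ‖(embA a : CInf F)‖ / (Fintype.card F : ℝ) ^ N := by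
  have h := (summable_term z a).sum_add_tsum_subtype_compl (degBall F N)
  rw [latticeTsum, latticeSum, ← h, add_sub_cancel_left]
  refine IsUltrametricDist.norm_tsum_le_of_forall_le_of_nonneg
    (div_nonneg (norm_nonneg _) (pow_pos card_pos N).le) fun b => ?_
  exact norm_term_le_of_notMem z a b.2 hN

theorem norm_sum_inv_add_le (w : CInf F) (δ : ℝ) (hδ : 0 < δ)
    (hw : ∀ c : F, δ ≤ ‖w + embA (C c)‖) :
    ‖∑ c : F, (w + embA (C c))⁻¹‖ ≤ δ⁻¹ * δ⁻¹ := by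
  have hw0 : δ ≤ ‖w‖ := by simpa using hw 0
  have hne : ∀ c : F, w + embA (C c) ≠ 0 := fun c => norm_pos_iff.1 (hδ.trans_le (hw c))
  have hne0 : w ≠ 0 := norm_pos_iff.1 (hδ.trans_le hw0)
  -- Subtract $q$ copies of $w^{-1}$, which add up to $0$. Each difference has a second factor in
  -- the denominator.
  have e : ∑ c : F, (w + embA (C c))⁻¹ = ∑ c : F, -(embA (C c) * w⁻¹ * (w + embA (C c))⁻¹) := by
    have h0 : ∑ _c : F, w⁻¹ = 0 := by
      rw [Finset.sum_const, Finset.card_univ, nsmul_eq_mul, card_cast_eq_zero, zero_mul]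
    rw [← sub_zero (∑ c : F, (w + embA (C c))⁻¹), ← h0, ← Finset.sum_sub_distrib]
    refine Finset.sum_congr rfl fun c _ => ?_
    have := hne c
    field_simp
    ring
  rw [e]
  refine IsUltrametricDist.norm_sum_le_of_forall_le_of_nonneg (by positivity) fun c _ => ?_
  have hc : ‖(embA (C c) : CInf F)‖ ≤ 1 := by
    rcases eq_or_ne c 0 with rfl | hc
    · simp
    · rw [norm_embA (C_ne_zero.2 hc), natDegree_C, pow_zero]
  rw [norm_neg, norm_mul, norm_mul, norm_inv, norm_inv]
  calc ‖(embA (C c) : CInf F)‖ * ‖w‖⁻¹ * ‖w + embA (C c)‖⁻¹ ≤ 1 * δ⁻¹ * δ⁻¹ := by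
        gcongr
        exact hw c
    _ = δ⁻¹ * δ⁻¹ := by rw [one_mul]

/-- The estimate `norm_sum_inv_add_le`, applied to each class of $b$ modulo constants, improves the
termwise bound by a factor of order $1/|a|$. This is what makes the sum over $a$ converge. -/
theorem norm_latticeSum_le (z : Omega F) {a : F[X]} (ha : a ≠ 0) {N : ℕ} (hN : 1 ≤ N) :
    ‖latticeSum N a (z : CInf F)‖ ≤ (imAbs z)⁻¹ ^ 2 / ‖(embA a : CInf F)‖ := by
  obtain ⟨N, rfl⟩ : ∃ N', N = N' + 1 := ⟨N - 1, by omega⟩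
  have hz := imAbs_pos z
  have ha' := norm_pos_iff.2 (embA_ne_zero (F := F) ha)
  rw [latticeSum, sum_degBall_succ]
  refine IsUltrametricDist.norm_sum_le_of_forall_le_of_nonneg (by positivity) fun b _ => ?_
  set δ : ℝ := ‖(embA a : CInf F)‖ * imAbs z with hδ
  have hδpos : 0 < δ := mul_pos ha' hz
  have e : ∑ c : F, embA a / (embA a * (z : CInf F) + embA (X * b + C c)) =
      embA a * ∑ c : F, (embA a * (z : CInf F) + embA (X * b) + embA (C c))⁻¹ := by
    rw [Finset.mul_sum]
    refine Finset.sum_congr rfl fun c _ => ?_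
    rw [map_add, add_assoc, div_eq_mul_inv]
  rw [e, norm_mul]
  have h := norm_sum_inv_add_le (embA a * (z : CInf F) + embA (X * b)) δ hδpos fun c => by
    rw [add_assoc, ← map_add]
    exact norm_embA_mul_imAbs_le z a _
  calc _ ≤ ‖(embA a : CInf F)‖ * (δ⁻¹ * δ⁻¹) := by gcongr
    _ = _ := by rw [hδ]; field_simp

theorem norm_latticeTsum_le (z : Omega F) {a : F[X]} (ha : a ≠ 0) :
    ‖latticeTsum a (z : CInf F)‖ ≤ (imAbs z)⁻¹ ^ 2 / ‖(embA a : CInf F)‖ := by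
  have hz := imAbs_pos z
  have ha' := norm_pos_iff.2 (embA_ne_zero (F := F) ha)
  obtain ⟨N₁, h₁⟩ := exists_lt_card_pow (F := F) (‖(embA a : CInf F)‖ * ‖(z : CInf F)‖)
  obtain ⟨N₂, h₂⟩ := exists_div_card_pow_lt (F := F) ‖(embA a : CInf F)‖
    (ε := (imAbs z)⁻¹ ^ 2 / ‖(embA a : CInf F)‖) (by positivity)
  set N := max (max N₁ N₂) 1 with hN
  have h3 := norm_latticeTsum_sub_le z a (N := N) (h₁.trans_le
    (pow_le_pow_right₀ one_lt_card.le ((le_max_left _ _).trans (le_max_left _ _))))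
  rw [← sub_add_cancel (latticeTsum a (z : CInf F)) (latticeSum N a z)]
  refine (IsUltrametricDist.norm_add_le_max _ _).trans (max_le ?_ ?_)
  · exact h3.trans (h₂ N ((le_max_right _ _).trans (le_max_left _ _))).le
  · exact norm_latticeSum_le z ha (le_max_right _ _)

theorem norm_latticeTsum_le_inv_imAbs (z : Omega F) {a : F[X]} (ha : a ≠ 0) :
    ‖latticeTsum a (z : CInf F)‖ ≤ (imAbs z)⁻¹ :=
  IsUltrametricDist.norm_tsum_le_of_forall_le_of_nonneg (inv_nonneg.2 (imAbs_pos z).le)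
    fun b => norm_term_le z ha b

theorem falseE_eq (π : CInf F) (z : Omega F) :
    falseE π z = π⁻¹ * ∑' a : {a : F[X] // a.Monic}, latticeTsum a.1 (z : CInf F) := rfl

theorem norm_falseE_le (π : CInf F) (z : Omega F) : ‖falseE π z‖ ≤ ‖π‖⁻¹ * (imAbs z)⁻¹ := by
  rw [falseE_eq, norm_mul, norm_inv]
  gcongr
  exact IsUltrametricDist.norm_tsum_le_of_forall_le_of_nonneg (inv_nonneg.2 (imAbs_pos z).le)
    fun a => norm_latticeTsum_le_inv_imAbs z a.2.ne_zero

theorem summable_latticeTsum (z : Omega F) :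
    Summable fun a : {a : F[X] // a.Monic} => latticeTsum a.1 (z : CInf F) := by
  apply NonarchimedeanAddGroup.summable_of_tendsto_cofinite_zero
  rw [NormedAddGroup.tendsto_nhds_zero]
  intro ε hε
  obtain ⟨N, h⟩ := exists_div_card_pow_lt (F := F) ((imAbs z)⁻¹ ^ 2) hε
  rw [Filter.eventually_cofinite]
  refine (monBall F N).finite_toSet.subset fun a ha => ?_
  by_contra ha'
  rw [Finset.mem_coe, mem_monBall] at ha'
  refine ha (((norm_latticeTsum_le z a.2.ne_zero).trans ?_).trans_lt (h N le_rfl))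
  have := pow_pos (card_pos (F := F)) N
  gcongr
  exact norm_embA_of_notMem_degBall ha'

/-- The partial sum of `π E`: the sum of `a / (a z + b)` over `a, b` of degree less than `N`, `a`
monic. -/
def partialE (N : ℕ) (z : CInf F) : CInf F := ∑ a ∈ monBall F N, latticeSum N a.1 z

/-- Uniform convergence on $\Omega_n$ over square boxes. It gives analyticity of $E$ and, through
the symmetry of the boxes, its behaviour under inversion. -/
theorem exists_norm_tsum_sub_partialE_le (n : ℕ) {ε : ℝ} (hε : 0 < ε) :
    ∃ N₀ : ℕ, ∀ N ≥ N₀, ∀ z ∈ OmegaAff (F := F) n,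
      ‖∑' a : {a : F[X] // a.Monic}, latticeTsum a.1 (z : CInf F) - partialE N (z : CInf F)‖ ≤ ε := by
  set q : ℝ := (Fintype.card F : ℝ) with hq
  have hqp : ∀ N : ℕ, 0 < q ^ N := fun N => pow_pos card_pos N
  obtain ⟨M, hM⟩ := exists_div_card_pow_lt (F := F) ((q ^ n) ^ 2) hε
  obtain ⟨N₁, hN₁⟩ := exists_div_card_pow_lt (F := F) (q ^ M) hε
  -- For $\deg a\ge M$ the decay in $a$ handles both the full and the truncated inner sums. For
  -- smaller $a$, $|a||z|\le q^{M+n}<q^N$, so the tail over $b$ is at most $q^M/q^N$.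
  refine ⟨max (M + n + 1) N₁, fun N hN z hz => ?_⟩
  have hNM : M + n + 1 ≤ N := (le_max_left _ _).trans hN
  have hbd : (imAbs z)⁻¹ ^ 2 ≤ (q ^ n) ^ 2 := by
    have h1 : (imAbs z)⁻¹ ≤ q ^ n := by
      rw [inv_le_comm₀ (imAbs_pos z) (hqp n)]
      exact hz.2
    have := inv_nonneg.2 (imAbs_pos z).le
    gcongr
  have hlarge : ∀ a : F[X], a ∉ degBall F M →
      (imAbs z)⁻¹ ^ 2 / ‖(embA a : CInf F)‖ ≤ ε := by
    intro a ha
    refine le_trans ?_ (hM M le_rfl).le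
    have := hqp M
    gcongr
    exact norm_embA_of_notMem_degBall ha
  have h := (summable_latticeTsum z).sum_add_tsum_subtype_compl (monBall F N)
  rw [partialE, ← h, add_sub_right_comm, ← Finset.sum_sub_distrib]
  refine (IsUltrametricDist.norm_add_le_max _ _).trans (max_le ?_ ?_)
  · refine IsUltrametricDist.norm_sum_le_of_forall_le_of_nonneg hε.le fun a _ => ?_
    by_cases ha : a.1 ∈ degBall F M
    · have hdeg : a.1.natDegree ≤ M := by
        rw [mem_degBall] at ha
        exact natDegree_le_iff_coeff_eq_zero.2 fun m hm => ha m hm.le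
      have hnorm : ‖(embA a.1 : CInf F)‖ ≤ q ^ M := by
        rw [norm_embA a.2.ne_zero]
        exact pow_le_pow_right₀ one_lt_card.le hdeg
      refine (norm_latticeTsum_sub_le z a.1 ?_).trans ?_
      · calc ‖(embA a.1 : CInf F)‖ * ‖(z : CInf F)‖ ≤ q ^ M * q ^ n := by
              gcongr
              exact hz.1
          _ = q ^ (M + n) := (pow_add _ _ _).symm
          _ < q ^ N := pow_lt_pow_right₀ one_lt_card (by omega)
      · refine le_trans ?_ (hN₁ N ((le_max_right _ _).trans hN)).le
        have := hqp N
        gcongr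
    · refine (norm_sub_le_max _ _).trans (max_le ?_ ?_)
      · exact (norm_latticeTsum_le z a.2.ne_zero).trans (hlarge _ ha)
      · exact (norm_latticeSum_le z a.2.ne_zero (by omega)).trans (hlarge _ ha)
  · refine IsUltrametricDist.norm_tsum_le_of_forall_le_of_nonneg hε.le fun a => ?_
    refine (norm_latticeTsum_le z a.1.2.ne_zero).trans (hlarge _ fun ha => a.2 ?_)
    rw [mem_monBall, mem_degBall]
    rw [mem_degBall] at ha
    exact fun m hm => ha m (by omega)

theorem isRigidAnalytic_falseE (π : CInf F) : IsRigidAnalytic (falseE π) := by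
  have h : IsRigidAnalytic fun z : Omega F =>
      ∑' a : {a : F[X] // a.Monic}, latticeTsum a.1 (z : CInf F) := by
    refine .of_approx fun n ε hε => ?_
    obtain ⟨N, hN⟩ := exists_norm_tsum_sub_partialE_le (F := F) n hε
    refine ⟨_, ?_, hN N le_rfl⟩
    refine IsRatOn.sum _ _ fun a _ => IsRatOn.sum _ _ fun b _ => ?_
    simp only [div_eq_mul_inv]
    exact (IsRatOn.const _).mul ((((IsRatOn.const _).mul .coe).add (.const _)).inv
      fun z _ => embA_mul_add_ne_zero z a.2.ne_zero b)
  exact h.const_mul _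

theorem tendsto_partialE (z : Omega F) :
    Filter.Tendsto (fun N => partialE N (z : CInf F)) Filter.atTop
      (nhds (∑' a : {a : F[X] // a.Monic}, latticeTsum a.1 (z : CInf F))) := by
  obtain ⟨n, hn⟩ := exists_mem_OmegaAff z
  rw [Metric.tendsto_atTop]
  intro ε hε
  obtain ⟨N₀, h⟩ := exists_norm_tsum_sub_partialE_le (F := F) n (half_pos hε)
  refine ⟨N₀, fun N hN => ?_⟩
  rw [dist_comm, dist_eq_norm]
  exact (h N hN z hn).trans_lt (half_lt_self hε)

/-! ### Transformation of the lattice sums -/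

theorem latticeSum_zero (N : ℕ) (z : CInf F) : latticeSum N 0 z = 0 := by
  simp [latticeSum]

theorem latticeSum_C_mul (N : ℕ) {c : F} (hc : c ≠ 0) (a : F[X]) (z : CInf F) :
    latticeSum N (C c * a) z = latticeSum N a z := by
  have hc' : C c⁻¹ * C c = (1 : F[X]) := by rw [← C_mul, inv_mul_cancel₀ hc, C_1]
  have hc'' : C c * C c⁻¹ = (1 : F[X]) := by rw [mul_comm, hc']
  refine Finset.sum_bij' (fun b _ => C c⁻¹ * b) (fun b _ => C c * b)
    (fun b hb => C_mul_mem_degBall _ hb) (fun b hb => C_mul_mem_degBall _ hb)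
    (fun b _ => by rw [← mul_assoc, hc'', one_mul])
    (fun b _ => by rw [← mul_assoc, hc', one_mul]) fun b _ => ?_
  have h0 : (embA (C c) : CInf F) ≠ 0 := embA_ne_zero (C_ne_zero.2 hc)
  have e : b = C c * (C c⁻¹ * b) := by rw [← mul_assoc, hc'', one_mul]
  rw [show (embA b : CInf F) = embA (C c) * embA (C c⁻¹ * b) by rw [← map_mul, ← e], map_mul,
    mul_assoc, ← mul_add, mul_div_mul_left _ _ h0]

theorem partialE_eq_neg_sum (N : ℕ) (z : CInf F) :
    partialE N z = -∑ a ∈ degBall F N, latticeSum N a z := by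
  rw [sum_degBall_eq_neg_sum_monBall N _ (latticeSum_zero N z)
    fun c hc a => latticeSum_C_mul N hc a z, neg_neg, partialE]

/-- Termwise $z\cdot az/(az+b)=z-zb/(az+b)$, and the constants $z$ sum to $0$ once $N\ge1$. -/
theorem sq_mul_latticeSum (z : Omega F) {N : ℕ} (hN : 1 ≤ N) {a : F[X]} (ha : a ≠ 0) :
    (z : CInf F) ^ 2 * latticeSum N a z =
      -(z * ∑ b ∈ degBall F N, embA b / (embA a * (z : CInf F) + embA b)) := by
  rw [latticeSum, Finset.mul_sum, Finset.mul_sum, ← zero_sub, ← sum_degBall_const hN (z : CInf F),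
    ← Finset.sum_sub_distrib]
  refine Finset.sum_congr rfl fun b _ => ?_
  have hne := embA_mul_add_ne_zero z ha b
  rw [← mul_div_assoc, ← mul_div_assoc, eq_sub_iff_add_eq, ← add_div, div_eq_iff hne]
  ring

theorem sum_latticeSum_neg_inv (z : Omega F) {N : ℕ} (hN : 1 ≤ N) :
    ∑ a ∈ degBall F N, latticeSum N a (-(z : CInf F)⁻¹) =
      (z : CInf F) ^ 2 * ∑ a ∈ degBall F N, latticeSum N a (z : CInf F) + z := by
  classical
  have hz := z.ne_zero
  set Y : F[X] → F[X] → CInf F := fun a b => embA b / (embA a * (z : CInf F) + embA b) with hY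
  have h1 : ∑ a ∈ degBall F N, latticeSum N a (-(z : CInf F)⁻¹) =
      -(z * ∑ a ∈ degBall F N, ∑ b ∈ degBall F N, Y a b) := by
    rw [Finset.sum_comm, Finset.mul_sum, ← Finset.sum_neg_distrib]
    refine Finset.sum_congr rfl fun a _ => ?_
    rw [Finset.mul_sum, ← Finset.sum_neg_distrib, latticeSum]
    refine Finset.sum_bij' (fun b _ => -b) (fun b _ => -b) ?_ ?_
      (fun b _ => neg_neg b) (fun b _ => neg_neg b) ?_
    · intro b hb
      simpa using C_mul_mem_degBall (-1) hb
    · intro b hb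
      simpa using C_mul_mem_degBall (-1) hb
    · intro b _
      simp only [hY, map_neg]
      have e : embA a * -(z : CInf F)⁻¹ + embA b =
          -((z : CInf F)⁻¹ * (-embA b * z + embA a)) := by
        field_simp
        ring
      rw [e, div_neg, div_mul_eq_div_div, div_inv_eq_mul, mul_comm (embA a), mul_div_assoc]
  have h2 : ∀ a ∈ degBall F N, (z : CInf F) ^ 2 * latticeSum N a (z : CInf F) =
      -(z * ∑ b ∈ degBall F N, Y a b) - if a = 0 then (z : CInf F) else 0 := by
    intro a _
    by_cases ha : a = 0
    · subst ha
      -- With $0/0=0$ the sum counts the nonzero $b$, and $q^N-1=-1$. This is the only origin of the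
      -- non-modular term of $E$.
      have h3 : ∑ b ∈ degBall F N, Y 0 b = -1 := by
        have h4 : ∀ b : F[X], Y 0 b = 1 - if b = 0 then 1 else 0 := by
          intro b
          by_cases hb : b = 0
          · simp [hY, hb]
          · simp [hY, hb, embA_ne_zero hb]
        simp only [h4]
        rw [Finset.sum_sub_distrib, sum_degBall_const hN, Finset.sum_ite_eq' (degBall F N) 0,
          if_pos (zero_mem_degBall N), zero_sub]
      rw [h3, latticeSum_zero, if_pos rfl]
      ring
    · rw [if_neg ha, sub_zero, sq_mul_latticeSum z hN ha]
  rw [h1, Finset.mul_sum (degBall F N) _ ((z : CInf F) ^ 2), Finset.sum_congr rfl h2, Finset.sum_sub_distrib,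
    Finset.sum_ite_eq' (degBall F N) 0, if_pos (zero_mem_degBall N), Finset.mul_sum,
    Finset.sum_neg_distrib]
  ring

theorem partialE_neg_inv (z : Omega F) {N : ℕ} (hN : 1 ≤ N) :
    partialE N (-(z : CInf F)⁻¹) = (z : CInf F) ^ 2 * partialE N (z : CInf F) - z := by
  rw [partialE_eq_neg_sum, partialE_eq_neg_sum, sum_latticeSum_neg_inv z hN]
  ring

theorem falseE_neg_inv (π : CInf F) (z w : Omega F) (hw : (w : CInf F) = -(z : CInf F)⁻¹) :
    falseE π w = (z : CInf F) ^ 2 * falseE π z - π⁻¹ * z := by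
  have h1 := tendsto_partialE w
  have h2 := ((tendsto_partialE z).const_mul ((z : CInf F) ^ 2)).sub_const (z : CInf F)
  have h3 := tendsto_nhds_unique_of_eventuallyEq h1 h2 (by
    filter_upwards [Filter.eventually_ge_atTop 1] with N hN
    rw [hw, partialE_neg_inv z hN])
  rw [falseE_eq, falseE_eq, h3]
  ring

theorem latticeTsum_C_mul_add {e : F} (he : e ≠ 0) (a c : F[X]) (z : CInf F) :
    latticeTsum a (embA (C e) * z + embA c) = (embA (C e))⁻¹ * latticeTsum a z := by
  have hu : IsUnit (C e : F[X]) := isUnit_C.2 he.isUnit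
  have h0 : (embA (C e) : CInf F) ≠ 0 := embA_ne_zero (C_ne_zero.2 he)
  rw [latticeTsum, latticeTsum, ← tsum_mul_left,
    -- The substitution $b\mapsto eb-ac$ permutes $A$ and absorbs the translation.
    ← ((Units.mulLeft hu.unit).trans (Equiv.subRight (a * c))).tsum_eq]
  congr 1
  ext b
  simp only [Equiv.trans_apply, Units.mulLeft_apply, IsUnit.unit_spec, Equiv.subRight_apply,
    map_sub, map_mul]
  rw [show embA a * (embA (C e) * z + embA c) + (embA (C e) * embA b - embA a * embA c) =
    embA (C e) * (embA a * z + embA b) by ring, div_mul_eq_div_div_swap, div_eq_inv_mul (_ / _)]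

theorem falseE_C_mul_add (π : CInf F) {e : F} (he : e ≠ 0) (c : F[X]) (z w : Omega F)
    (hw : (w : CInf F) = embA (C e) * z + embA c) :
    falseE π w = (embA (C e))⁻¹ * falseE π z := by
  simp only [falseE_eq, hw, latticeTsum_C_mul_add he]
  rw [tsum_mul_left]
  ring

/-! ### The stabilizer of `E` under the double slash action -/

/-- `E ‖ γ = E |_{2,1} γ + π⁻¹ c / (c z + d)`, the double slash operator applied to `E`. -/
def dslashE (π : CInf F) (γ : GL (Fin 2) (RatFunc F)) : Omega F → CInf F :=
  fun z => slash 2 1 (falseE π) γ z + π⁻¹ * kappa γ z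

theorem kappa_eq_zero {γ : GL (Fin 2) (RatFunc F)} (h : γ 1 0 = 0) (z : Omega F) :
    kappa γ z = 0 := by
  simp [kappa, h]

theorem dslashE_one (π : CInf F) : dslashE π 1 = falseE π := by
  ext z
  rw [dslashE, slash_one, kappa_eq_zero (by simp), mul_zero, add_zero]

theorem dslashE_mul (π : CInf F) (γ δ : GL (Fin 2) (RatFunc F)) (z : Omega F) :
    dslashE π (γ * δ) z = slash 2 1 (dslashE π γ) δ z + π⁻¹ * kappa δ z := by
  have h := slash_add 2 1 (slash 2 1 (falseE π) γ) (fun w => π⁻¹ * kappa γ w) δ z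
  rw [slash_const_mul] at h
  rw [dslashE, kappa_mul, slash_mul_right]
  unfold dslashE
  rw [h]
  ring

/-- The stabilizer of `E` under the double slash action. -/
def stabilizerE (π : CInf F) : Subgroup (GL (Fin 2) (RatFunc F)) where
  carrier := {γ | dslashE π γ = falseE π}
  one_mem' := dslashE_one π
  mul_mem' := by
    intro γ δ hγ hδ
    ext z
    rw [Set.mem_ofPred_eq] at hγ hδ
    rw [dslashE_mul, hγ]
    exact congrFun hδ z
  inv_mem' := by
    intro γ hγ
    rw [Set.mem_ofPred_eq] at hγ ⊢
    rw [← dslashE_one π, ← mul_inv_cancel γ]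
    ext z
    rw [dslashE_mul π γ, hγ]
    rfl

theorem dslashE_of_mem {π : CInf F} {γ : GL (Fin 2) (RatFunc F)} (h : γ ∈ stabilizerE π) :
    dslashE π γ = falseE π := h

/-- The reason for introducing the stabilizer: $\gamma$ may be replaced by any convenient
representative of its left coset. -/
theorem dslashE_mul_of_mem {π : CInf F} {α : GL (Fin 2) (RatFunc F)} (h : α ∈ stabilizerE π)
    (γ : GL (Fin 2) (RatFunc F)) : dslashE π (α * γ) = dslashE π γ := by
  ext z
  rw [dslashE_mul, dslashE_of_mem h]
  rfl

theorem mem_Gamma0_iff {𝔪 : Ideal F[X]} {γ : GL (Fin 2) (RatFunc F)} :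
    γ ∈ Gamma0 𝔪 ↔ ∃ a b c d : F[X], γ 0 0 = algebraMap F[X] (RatFunc F) a ∧
      γ 0 1 = algebraMap F[X] (RatFunc F) b ∧ γ 1 0 = algebraMap F[X] (RatFunc F) c ∧
      γ 1 1 = algebraMap F[X] (RatFunc F) d ∧ c ∈ 𝔪 ∧ IsUnit (a * d - b * c) := by
  constructor
  · rintro ⟨g, hg, rfl⟩
    refine ⟨g 0 0, g 0 1, g 1 0, g 1 1, rfl, rfl, rfl, rfl, hg, ?_⟩
    have h := (Matrix.isUnit_iff_isUnit_det _).1 g.isUnit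
    rwa [Matrix.det_fin_two] at h
  · rintro ⟨a, b, c, d, ha, hb, hc, hd, hm, hu⟩
    refine ⟨Matrix.GeneralLinearGroup.mk'' !![a, b; c, d] (by rwa [Matrix.det_fin_two_of]), ?_, ?_⟩
    · exact hm
    · apply Units.ext
      ext i j
      fin_cases i <;> fin_cases j
      · exact ha.symm
      · exact hb.symm
      · exact hc.symm
      · exact hd.symm

theorem Gamma0_mono {𝔪 𝔫 : Ideal F[X]} (h : 𝔪 ≤ 𝔫) : Gamma0 𝔪 ≤ Gamma0 𝔫 := by
  intro γ hγ
  obtain ⟨a, b, c, d, ha, hb, hc, hd, hm, hu⟩ := mem_Gamma0_iff.1 hγ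
  exact mem_Gamma0_iff.2 ⟨a, b, c, d, ha, hb, hc, hd, h hm, hu⟩

/-- The matrix `(a b; c d)` in `GL₂(K)`, for `a, b, c, d ∈ A` with nonzero determinant. -/
def matA (a b c d : F[X]) (h : a * d - b * c ≠ 0) : GL (Fin 2) (RatFunc F) :=
  Matrix.GeneralLinearGroup.mkOfDetNeZero
    !![algebraMap F[X] (RatFunc F) a, algebraMap F[X] (RatFunc F) b;
      algebraMap F[X] (RatFunc F) c, algebraMap F[X] (RatFunc F) d]
    (by
      rw [Matrix.det_fin_two_of, ← map_mul, ← map_mul, ← map_sub]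
      exact (map_ne_zero_iff _ (RatFunc.algebraMap_injective F)).2 h)

theorem coe_matA (a b c d : F[X]) (h : a * d - b * c ≠ 0) :
    (matA a b c d h : Matrix (Fin 2) (Fin 2) (RatFunc F)) =
      !![algebraMap F[X] (RatFunc F) a, algebraMap F[X] (RatFunc F) b;
        algebraMap F[X] (RatFunc F) c, algebraMap F[X] (RatFunc F) d] := rfl

theorem matA_mem_Gamma0 {𝔪 : Ideal F[X]} (a b c d : F[X]) (h : a * d - b * c ≠ 0)
    (hu : IsUnit (a * d - b * c)) (hc : c ∈ 𝔪) : matA a b c d h ∈ Gamma0 𝔪 :=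
  mem_Gamma0_iff.2 ⟨a, b, c, d, rfl, rfl, rfl, rfl, hc, hu⟩

/-- The translation `z ↦ z + b`. -/
def transMat (b : F[X]) : GL (Fin 2) (RatFunc F) := matA 1 b 0 1 (by simp)

variable (F) in
/-- The inversion `z ↦ -1 / z`. -/
def invMat : GL (Fin 2) (RatFunc F) := matA 0 (-1) 1 0 (by simp)

theorem transMat_mem_Gamma0 (𝔪 : Ideal F[X]) (b : F[X]) : transMat b ∈ Gamma0 𝔪 :=
  matA_mem_Gamma0 _ _ _ _ _ (by simp) (zero_mem _)

theorem invMat_mem_Gamma0 : invMat F ∈ Gamma0 (⊤ : Ideal F[X]) :=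
  matA_mem_Gamma0 _ _ _ _ _ (by simp) trivial

theorem denom_of_entry_eq_zero {γ : GL (Fin 2) (RatFunc F)} (h : γ 1 0 = 0) (z : Omega F) :
    denom γ z = embK (γ 1 1) := by
  simp [denom, h]

/-- The diagonal entries are constants $e_1,e_2$. The substitution $z\mapsto(e_1/e_2)z+b/e_2$
multiplies $E$ by $e_2/e_1$, which the automorphy factor $e_1e_2\cdot e_2^{-2}$ cancels. -/
theorem mem_stabilizerE_of_entry_eq_zero (π : CInf F) {γ : GL (Fin 2) (RatFunc F)}
    (hγ : γ ∈ Gamma0 (⊤ : Ideal F[X])) (h0 : γ 1 0 = 0) : γ ∈ stabilizerE π := by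
  obtain ⟨a, b, c, d, ha, hb, hc, hd, -, hu⟩ := mem_Gamma0_iff.1 hγ
  have hc0 : c = 0 := by
    rw [hc] at h0
    exact (map_eq_zero_iff _ (RatFunc.algebraMap_injective F)).1 h0
  subst hc0
  rw [mul_zero, sub_zero, IsUnit.mul_iff, isUnit_iff, isUnit_iff] at hu
  obtain ⟨⟨e₁, hu₁, rfl⟩, ⟨e₂, hu₂, rfl⟩⟩ := hu
  have h1 : (embA (C e₁) : CInf F) ≠ 0 := embA_ne_zero (C_ne_zero.2 hu₁.ne_zero)
  have h2 : (embA (C e₂) : CInf F) ≠ 0 := embA_ne_zero (C_ne_zero.2 hu₂.ne_zero)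
  have hinv : (embA (C e₂⁻¹) : CInf F) = (embA (C e₂))⁻¹ := by
    refine eq_inv_of_mul_eq_one_left ?_
    rw [← map_mul, ← C_mul, inv_mul_cancel₀ hu₂.ne_zero, C_1, map_one]
  change dslashE π γ = falseE π
  ext z
  have hden := denom_of_entry_eq_zero h0 z
  rw [hd, embK_algebraMap] at hden
  have he : e₁ * e₂⁻¹ ≠ 0 := mul_ne_zero hu₁.ne_zero (inv_ne_zero hu₂.ne_zero)
  rw [dslashE, kappa_eq_zero h0, mul_zero, add_zero, slash_apply, hden,
    falseE_C_mul_add π he (C e₂⁻¹ * b) z (mob γ z), detC_eq, ha, hd, h0, map_zero, mul_zero,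
    sub_zero, C_mul, map_mul, hinv, embK_algebraMap, embK_algebraMap]
  · rw [zpow_one, zpow_neg]
    have e2 : (embA (C e₂) : CInf F) ^ (2 : ℤ) = embA (C e₂) ^ 2 := by norm_cast
    rw [e2]
    field_simp
  · rw [coe_mob, hden, ha, hb, embK_algebraMap, embK_algebraMap, C_mul, map_mul, map_mul, hinv]
    field_simp

theorem transMat_mem_stabilizerE (π : CInf F) (b : F[X]) : transMat b ∈ stabilizerE π :=
  mem_stabilizerE_of_entry_eq_zero π (transMat_mem_Gamma0 ⊤ b) (map_zero (algebraMap F[X] (RatFunc F)))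

theorem invMat_mem_stabilizerE (π : CInf F) : invMat F ∈ stabilizerE π := by
  change dslashE π (invMat F) = falseE π
  ext z
  have h00 : (invMat F) 0 0 = 0 := map_zero (algebraMap F[X] (RatFunc F))
  have h01 : (invMat F) 0 1 = -1 := by
    change algebraMap F[X] (RatFunc F) (-1) = -1
    simp
  have h10 : (invMat F) 1 0 = 1 := map_one (algebraMap F[X] (RatFunc F))
  have h11 : (invMat F) 1 1 = 0 := map_zero (algebraMap F[X] (RatFunc F))
  have hz := z.ne_zero
  have hden : denom (invMat F) z = z := by simp [denom, h10, h11]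
  rw [dslashE, slash_apply, hden, falseE_neg_inv π z (mob (invMat F) z), detC_eq, kappa, hden, h00,
    h01, h10, h11]
  · simp only [map_zero, map_neg, map_one, zero_mul, zero_sub, neg_mul, one_mul, neg_neg, one_zpow]
    rw [zpow_neg]
    have e2 : (z : CInf F) ^ (2 : ℤ) = (z : CInf F) ^ 2 := by norm_cast
    rw [e2]
    field_simp
    ring
  · rw [coe_mob, hden, h00, h01]
    simp [neg_div]

/-- Euclid's algorithm on the first column. Allowing $\gamma\in GL_2(K)$ lets it serve both for the
invariance of $E$ under $GL_2(A)$ and for growth at the cusps. -/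
theorem exists_mul_entry_eq_zero (H : Subgroup (GL (Fin 2) (RatFunc F)))
    (ht : ∀ b, transMat b ∈ H) (hw : invMat F ∈ H) (γ : GL (Fin 2) (RatFunc F)) :
    ∃ α ∈ H, (α * γ) 1 0 = 0 := by
  have key : ∀ R : F[X], ∀ P D : F[X], D ≠ 0 → ∀ γ : GL (Fin 2) (RatFunc F),
      γ 0 0 = algebraMap F[X] (RatFunc F) P / algebraMap F[X] (RatFunc F) D →
      γ 1 0 = algebraMap F[X] (RatFunc F) R / algebraMap F[X] (RatFunc F) D →
      ∃ α ∈ H, (α * γ) 1 0 = 0 := by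
    intro R
    induction R using (EuclideanDomain.r_wellFounded (R := F[X])).induction with
    | _ R ih =>
    intro P D hD γ h0 h1
    by_cases hR : R = 0
    · exact ⟨1, H.one_mem, by simp [h1, hR]⟩
    -- One division step: the translation reduces $P$ modulo $R$, and the inversion turns the column
    -- $(P\bmod R,\,R)$ into $(-R,\,P\bmod R)$. The denominator $D$ stays fixed.
    have hmul : ∀ i, (invMat F * (transMat (-(P / R)) * γ)) i 0 =
        algebraMap F[X] (RatFunc F) (if i = 0 then -R else P % R) /
          algebraMap F[X] (RatFunc F) D := by
      have e : P % R = P - R * (P / R) := by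
        rw [eq_sub_iff_add_eq, add_comm, EuclideanDomain.div_add_mod]
      intro i
      fin_cases i
      all_goals
        simp only [Units.val_mul, Matrix.mul_apply, Fin.sum_univ_two, h0, h1, invMat, transMat,
          coe_matA]
        simp [e]
        try ring
    obtain ⟨α, hα, h⟩ := ih (P % R) (EuclideanDomain.mod_lt P hR) (-R) D hD _ (hmul 0) (hmul 1)
    refine ⟨α * (invMat F * transMat (-(P / R))), H.mul_mem hα (H.mul_mem hw (ht _)), ?_⟩
    rwa [mul_assoc, mul_assoc]
  have hn : ∀ r : RatFunc F, algebraMap F[X] (RatFunc F) r.denom ≠ 0 := fun r =>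
    (map_ne_zero_iff _ (RatFunc.algebraMap_injective F)).2 r.denom_ne_zero
  refine key ((γ 1 0).num * (γ 0 0).denom) ((γ 0 0).num * (γ 1 0).denom)
    ((γ 0 0).denom * (γ 1 0).denom) (mul_ne_zero (RatFunc.denom_ne_zero _)
    (RatFunc.denom_ne_zero _)) γ ?_ ?_
  · rw [map_mul, map_mul, mul_div_mul_right _ _ (hn _), RatFunc.num_div_denom]
  · rw [map_mul, map_mul, mul_comm (algebraMap F[X] (RatFunc F) (γ 0 0).denom),
      mul_div_mul_right _ _ (hn _), RatFunc.num_div_denom]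

theorem Gamma0_le_stabilizerE (π : CInf F) (𝔪 : Ideal F[X]) : Gamma0 𝔪 ≤ stabilizerE π := by
  refine (Gamma0_mono le_top).trans fun γ hγ => ?_
  -- Working in the intersection with $GL_2(A)$ keeps the triangular matrix $\alpha\gamma$ integral.
  obtain ⟨α, ⟨hα, hα'⟩, h⟩ := exists_mul_entry_eq_zero (stabilizerE π ⊓ Gamma0 ⊤)
    (fun b => ⟨transMat_mem_stabilizerE π b, transMat_mem_Gamma0 ⊤ b⟩)
    ⟨invMat_mem_stabilizerE π, invMat_mem_Gamma0⟩ γ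
  have h2 := mem_stabilizerE_of_entry_eq_zero π ((Gamma0 ⊤).mul_mem hα' hγ) h
  exact ((stabilizerE π).mul_mem_cancel_left hα).1 h2

/-! ### Boundedness on vertical lines -/

namespace BoundedOnVerticalLines

variable {f g : Omega F → CInf F}

theorem const (c : CInf F) : BoundedOnVerticalLines (fun _ : Omega F => c) :=
  ⟨‖c‖, 0, fun _ _ => le_rfl⟩

theorem add (hf : BoundedOnVerticalLines f) (hg : BoundedOnVerticalLines g) :
    BoundedOnVerticalLines (fun z => f z + g z) := by
  obtain ⟨B, R, h⟩ := hf
  obtain ⟨B', R', h'⟩ := hg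
  refine ⟨B + B', max R R', fun z hz => (norm_add_le _ _).trans ?_⟩
  exact add_le_add (h z ((le_max_left _ _).trans hz)) (h' z ((le_max_right _ _).trans hz))

theorem mul (hf : BoundedOnVerticalLines f) (hg : BoundedOnVerticalLines g) :
    BoundedOnVerticalLines (fun z => f z * g z) := by
  obtain ⟨B, R, h⟩ := hf
  obtain ⟨B', R', h'⟩ := hg
  refine ⟨B * B', max R R', fun z hz => ?_⟩
  rw [norm_mul]
  have h1 := h z ((le_max_left _ _).trans hz)
  exact mul_le_mul h1 (h' z ((le_max_right _ _).trans hz)) (norm_nonneg _)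
    ((norm_nonneg _).trans h1)

theorem const_mul (c : CInf F) (hf : BoundedOnVerticalLines f) :
    BoundedOnVerticalLines (fun z => c * f z) :=
  (const c).mul hf

theorem sub (hf : BoundedOnVerticalLines f) (hg : BoundedOnVerticalLines g) :
    BoundedOnVerticalLines (fun z => f z - g z) := by
  simpa [sub_eq_add_neg] using hf.add (hg.const_mul (-1))

theorem pow (hf : BoundedOnVerticalLines f) (n : ℕ) :
    BoundedOnVerticalLines (fun z => f z ^ n) := by
  induction n with
  | zero => simpa using const (F := F) 1
  | succ n ih => simpa only [pow_succ] using ih.mul hf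

theorem sum {ι : Type*} (s : Finset ι) (f : ι → Omega F → CInf F)
    (hf : ∀ i ∈ s, BoundedOnVerticalLines (f i)) :
    BoundedOnVerticalLines (fun z => ∑ i ∈ s, f i z) := by
  classical
  induction s using Finset.induction_on with
  | empty => simpa using const (F := F) 0
  | insert i s hi ih =>
    simp only [Finset.sum_insert hi]
    exact (hf i (Finset.mem_insert_self i s)).add
      (ih fun j hj => hf j (Finset.mem_insert_of_mem hj))

end BoundedOnVerticalLines

theorem boundedOnVerticalLines_kappa (γ : GL (Fin 2) (RatFunc F)) :
    BoundedOnVerticalLines (kappa γ) := by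
  refine ⟨1, 1, fun z hz => ?_⟩
  refine le_trans ?_ (norm_kappa_mul_imAbs_le_one γ z)
  exact le_mul_of_one_le_right (norm_nonneg _) hz

theorem mul_imAbs_le_imAbs_mob {γ : GL (Fin 2) (RatFunc F)} (h : γ 1 0 = 0) (z : Omega F) :
    ‖(embK (γ 0 0) : CInf F)‖ / ‖(embK (γ 1 1) : CInf F)‖ * imAbs z ≤ imAbs (mob γ z) := by
  refine (Metric.le_infDist (Set.range_nonempty _)).2 ?_
  rintro _ ⟨x, rfl⟩
  have hd : embK (γ 1 1) ≠ (0 : CInf F) := by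
    have := denom_ne_zero γ z
    rwa [denom_of_entry_eq_zero h] at this
  have hd' := norm_pos_iff.2 hd
  have h1 := norm_mul_imAbs_le z (algebraMap (RatFunc F) (KInf F) (γ 0 0))
    (algebraMap (RatFunc F) (KInf F) (γ 0 1) - x * algebraMap (RatFunc F) (KInf F) (γ 1 1))
  rw [← norm_algebraMap' (CInf F)] at h1
  have e : (mob γ z : CInf F) - algebraMap (KInf F) (CInf F) x =
      (embK (γ 0 0) * z + (embK (γ 0 1) - algebraMap (KInf F) (CInf F) x * embK (γ 1 1))) /
        embK (γ 1 1) := by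
    rw [coe_mob, denom_of_entry_eq_zero h]
    field_simp
    ring
  rw [dist_eq_norm, e, norm_div, div_mul_eq_mul_div]
  gcongr
  simpa [embK] using h1

/-- There is essentially one cusp: up to the stabilizer $\gamma$ is upper triangular. Then
$E\|\gamma$ is a constant times $E$ at an affine image of $z$, whose imaginary part grows linearly,
while $|E(w)|\le|\tilde\pi|^{-1}/|w|_i$. -/
theorem boundedOnVerticalLines_dslashE (π : CInf F) (γ : GL (Fin 2) (RatFunc F)) :
    BoundedOnVerticalLines (dslashE π γ) := by
  obtain ⟨α, hα, h⟩ := exists_mul_entry_eq_zero (stabilizerE π)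
    (transMat_mem_stabilizerE π) (invMat_mem_stabilizerE π) γ
  rw [← dslashE_mul_of_mem hα γ]
  set β := α * γ with hβ
  have hd : ∀ z, denom β z = embK (β 1 1) := denom_of_entry_eq_zero h
  have hdet := detC_ne_zero β
  rw [detC_eq, h, map_zero, mul_zero, sub_zero] at hdet
  set r : ℝ := ‖(embK (β 0 0) : CInf F)‖ / ‖(embK (β 1 1) : CInf F)‖ with hr
  have hrpos : 0 < r := div_pos (norm_pos_iff.2 (left_ne_zero_of_mul hdet))
    (norm_pos_iff.2 (right_ne_zero_of_mul hdet))
  refine ⟨‖detC β ^ (1 : ℤ) * embK (β 1 1) ^ (-2 : ℤ)‖ * (‖π‖⁻¹ * r⁻¹), 1, fun z hz => ?_⟩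
  rw [dslashE, kappa_eq_zero h, mul_zero, add_zero, slash_apply, hd, norm_mul]
  gcongr
  refine (norm_falseE_le π _).trans ?_
  gcongr
  refine le_trans ?_ (mul_imAbs_le_imAbs_mob h z)
  exact le_mul_of_one_le_right hrpos.le hz

theorem slash_falseE (π : CInf F) (γ : GL (Fin 2) (RatFunc F)) (z : Omega F) :
    slash 2 1 (falseE π) γ z = dslashE π γ z - π⁻¹ * kappa γ z := by
  rw [dslashE, add_sub_cancel_right]

theorem boundedOnVerticalLines_slash_falseE (π : CInf F) (γ : GL (Fin 2) (RatFunc F)) :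
    BoundedOnVerticalLines (slash 2 1 (falseE π) γ) := by
  rw [show slash 2 1 (falseE π) γ = _ from funext (slash_falseE π γ)]
  exact (boundedOnVerticalLines_dslashE π γ).sub ((boundedOnVerticalLines_kappa γ).const_mul _)

theorem isRigidAnalytic_dslashE (π : CInf F) (γ : GL (Fin 2) (RatFunc F)) :
    IsRigidAnalytic (dslashE π γ) :=
  ((isRigidAnalytic_falseE π).slash 2 1 γ).add ((IsRigidAnalytic.kappa γ).const_mul _)

/-! ### Modular forms -/

theorem mob_transMat (b : F[X]) (z : Omega F) :
    (mob (transMat b) z : CInf F) = (z : CInf F) + embA b := by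
  rw [coe_mob, denom]
  simp [transMat, coe_matA, embK_algebraMap]

theorem slash_transMat (k m : ℤ) (f : Omega F → CInf F) (b : F[X]) (z : Omega F) :
    slash k m f (transMat b) z = f (mob (transMat b) z) := by
  rw [slash_apply, detC_eq, denom]
  simp [transMat, coe_matA]

/-- `f` is `A`-periodic. -/
def IsAPeriodic (f : Omega F → CInf F) : Prop := ∀ (b : F[X]) z, f (mob (transMat b) z) = f z

theorem IsAPeriodic.isPeriodic {f : Omega F → CInf F} (hf : IsAPeriodic f) : IsPeriodic f := by
  refine ⟨⊤, top_ne_bot, fun a _ z w h => ?_⟩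
  rw [← hf a z]
  congr 1
  exact Subtype.ext (h.trans (mob_transMat a z).symm)

theorem isAPeriodic_falseE (π : CInf F) : IsAPeriodic (falseE π) := by
  intro b z
  rw [← slash_transMat 2 1 (falseE π), slash_falseE, dslashE_of_mem (transMat_mem_stabilizerE π b),
    kappa_eq_zero (by simp [transMat, coe_matA]), mul_zero, sub_zero]

theorem isAPeriodic_of_slash_eq {k m : ℤ} {f : Omega F → CInf F} {𝔪 : Ideal F[X]}
    (hf : ∀ γ ∈ Gamma0 𝔪, slash k m f γ = f) : IsAPeriodic f := by
  intro b z
  rw [← slash_transMat k m f, hf _ (transMat_mem_Gamma0 𝔪 b)]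

/-- Taking $\gamma=1$ forces the constant polynomial to be $f$. Periodicity is automatic since
translations by $A$ lie in $\Gamma_0(\mathfrak m)$. -/
theorem isModularForm_iff {𝔪 : Ideal F[X]} {k m : ℤ} {f : Omega F → CInf F} :
    IsModularForm (Gamma0 𝔪) k m f ↔ IsRigidAnalytic f ∧ (∀ γ ∈ Gamma0 𝔪, slash k m f γ = f) ∧
      ∀ γ, BoundedOnVerticalLines (slash k m f γ) := by
  constructor
  · rintro ⟨hr, P, ⟨-, hP⟩, hdeg, hb⟩
    have h1 : ∀ γ ∈ Gamma0 𝔪, slash k m f γ = P.coeff 0 := by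
      intro γ hγ
      ext z
      rw [hP γ hγ z, Nat.le_zero.1 hdeg]
      simp
    have h2 : f = P.coeff 0 := by
      rw [← h1 1 (one_mem _), slash_one]
    refine ⟨hr, fun γ hγ => (h1 γ hγ).trans h2.symm, fun γ => ?_⟩
    have h3 := hb 0 γ
    rw [← h2] at h3
    simpa using h3
  · rintro ⟨hr, hs, hb⟩
    refine ⟨hr, C f, ⟨fun i => ?_, fun γ hγ z => ?_⟩, by simp, fun i γ => ?_⟩
    · rcases eq_or_ne i 0 with rfl | hi
      · rw [coeff_C_zero]
        exact ⟨hr, (isAPeriodic_of_slash_eq hs).isPeriodic⟩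
      · rw [coeff_C_of_ne_zero hi]
        exact ⟨IsRigidAnalytic.const 0, ⟨⊤, top_ne_bot, fun _ _ _ _ _ => rfl⟩⟩
    · rw [hs γ hγ]
      simp
    · rcases eq_or_ne i 0 with rfl | hi
      · simpa using hb γ
      · rw [coeff_C_of_ne_zero hi]
        convert BoundedOnVerticalLines.const (F := F) 0 using 1
        ext z
        simp [slash_apply]

theorem isModularForm_zero (𝔪 : Ideal F[X]) (k m : ℤ) :
    IsModularForm (Gamma0 𝔪) k m (fun _ => 0) := by
  have h : ∀ γ : GL (Fin 2) (RatFunc F), slash k m (fun _ => 0) γ = fun _ => 0 := by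
    intro γ
    ext z
    simp [slash_apply]
  refine isModularForm_iff.2 ⟨.const 0, fun γ _ => h γ, fun γ => ?_⟩
  rw [h]
  exact .const 0

/-! ### Uniqueness of the associated polynomial -/

theorem infinite_ideal {𝔪 : Ideal F[X]} (h𝔪 : 𝔪 ≠ ⊥) : Infinite 𝔪 := by
  obtain ⟨x, hx, hx0⟩ := Submodule.exists_mem_ne_zero_of_ne_bot h𝔪
  refine Infinite.of_injective (fun n : ℕ => (⟨X ^ n * x, 𝔪.mul_mem_left _ hx⟩ : 𝔪)) ?_
  intro n n' h
  have h' : (X : F[X]) ^ n = X ^ n' := mul_right_cancel₀ hx0 (congrArg Subtype.val h)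
  simpa using congrArg natDegree h'

instance instInfiniteCInf : Infinite (CInf F) := Infinite.of_injective _ embA_injective

/-- The matrices $(1\ 0;\ c\ 1)$ with $c\in\mathfrak m$ give pairwise distinct values $c/(cz+1)$. -/
theorem infinite_kappa {𝔪 : Ideal F[X]} (h𝔪 : 𝔪 ≠ ⊥) (z : Omega F) :
    {x | ∃ γ ∈ Gamma0 𝔪, kappa γ z = x}.Infinite := by
  have := infinite_ideal h𝔪
  refine Set.infinite_of_injective_forall_mem
    (f := fun c : 𝔪 => kappa (matA 1 0 c 1 (by simp)) z) ?_ ?_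
  · intro c c' h
    have hc : ∀ c : F[X], kappa (matA 1 0 c 1 (by simp)) z =
        embA c / (embA c * (z : CInf F) + 1) := by
      intro c
      rw [kappa, denom]
      simp [coe_matA, embK_algebraMap]
    have hne : ∀ c : F[X], embA c * (z : CInf F) + 1 ≠ 0 := by
      intro c
      rcases eq_or_ne c 0 with rfl | h0
      · simp
      · simpa using embA_mul_add_ne_zero z h0 1
    simp only [hc] at h
    rw [div_eq_div_iff (hne _) (hne _)] at h
    refine Subtype.ext (embA_injective ?_)
    linear_combination h
  · intro c
    exact ⟨_, matA_mem_Gamma0 _ _ _ _ _ (by simp) c.2, rfl⟩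

theorem sum_range_coeff_mul {P : (Omega F → CInf F)[X]} {n : ℕ} (h : P.natDegree ≤ n)
    (x : ℕ → (Omega F → CInf F) → CInf F) (hx : ∀ i, x i 0 = 0) :
    ∑ i ∈ Finset.range (P.natDegree + 1), x i (P.coeff i) =
      ∑ i ∈ Finset.range (n + 1), x i (P.coeff i) := by
  refine Finset.sum_subset (Finset.range_subset_range.2 (by omega)) fun i _ hi => ?_
  rw [Finset.mem_range, not_lt] at hi
  rw [coeff_eq_zero_of_natDegree_lt (by omega), hx]

/-- The coefficient ring of functions is not a domain, so specialise at each $z$: two polynomials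
over the field $\mathbb C_\infty$ agree at the infinitely many $\kappa_\gamma(z)$. -/
theorem IsAssocPoly.unique {𝔪 : Ideal F[X]} (h𝔪 : 𝔪 ≠ ⊥) {k m : ℤ} {f : Omega F → CInf F}
    {P P' : (Omega F → CInf F)[X]} (h : IsAssocPoly (Gamma0 𝔪) k m f P)
    (h' : IsAssocPoly (Gamma0 𝔪) k m f P') : P = P' := by
  have hev : ∀ (Q : (Omega F → CInf F)[X]) (z : Omega F) (x : CInf F),
      ∑ i ∈ Finset.range (Q.natDegree + 1), Q.coeff i z * x ^ i =
        (Q.map (Pi.evalRingHom (fun _ => CInf F) z)).eval x := by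
    intro Q z x
    rw [eval_map, eval₂_eq_sum_range]
    rfl
  have hz : ∀ z, P.map (Pi.evalRingHom (fun _ => CInf F) z) =
      P'.map (Pi.evalRingHom (fun _ => CInf F) z) := by
    intro z
    refine eq_of_infinite_eval_eq _ _ ((infinite_kappa h𝔪 z).mono ?_)
    rintro _ ⟨γ, hγ, rfl⟩
    rw [Set.mem_ofPred_eq, ← hev, ← hev, ← h.2 γ hγ z, h'.2 γ hγ z]
  ext i z
  have := congrArg (fun Q => Q.coeff i) (hz z)
  simpa [coeff_map] using this

theorem IsAssocPoly.assocPoly_eq {𝔪 : Ideal F[X]} (h𝔪 : 𝔪 ≠ ⊥) {k m : ℤ} {f : Omega F → CInf F}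
    {P : (Omega F → CInf F)[X]} (h : IsAssocPoly (Gamma0 𝔪) k m f P) :
    assocPoly (Gamma0 𝔪) k m f = P := by
  have hex : ∃ P, IsAssocPoly (Gamma0 𝔪) k m f P := ⟨P, h⟩
  rw [assocPoly, dif_pos hex]
  exact hex.choose_spec.unique h𝔪 h

/-! ### Polynomials in `E` with modular coefficients -/

/-- With $b=-\tilde\pi^{-1}$ it serves twice: $(e,x)=(E,\kappa_\gamma)$ yields the associated
polynomial, and $(e,x)=(E|\gamma,-\kappa_\gamma)$ the double slash. -/
theorem sum_binomial_mul_pow (n : ℕ) (c : ℕ → CInf F) (e b x : CInf F) :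
    ∑ i ∈ Finset.range (n + 1),
      (b ^ i * ∑ h ∈ Finset.range (n + 1), (h.choose i : CInf F) * (c h * e ^ (h - i))) * x ^ i =
    ∑ h ∈ Finset.range (n + 1), c h * (e + b * x) ^ h := by
  simp only [Finset.mul_sum, Finset.sum_mul]
  rw [Finset.sum_comm]
  refine Finset.sum_congr rfl fun h hh => ?_
  rw [add_comm e, add_pow, Finset.mul_sum]
  rw [Finset.mem_range] at hh
  refine (Finset.sum_subset (Finset.range_subset_range.2 (by omega)) fun i _ hi => ?_).symm.trans
    (Finset.sum_congr rfl fun i _ => ?_)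
  · rw [Finset.mem_range, not_lt] at hi
    rw [Nat.choose_eq_zero_of_lt (by omega)]
    simp
  · rw [mul_pow]
    ring

/-- The coefficient of `X ^ i` in `∑_h c_h (E - π⁻¹ X) ^ h`. -/
def eExpCoeff (π : CInf F) (n : ℕ) (c : ℕ → Omega F → CInf F) (i : ℕ) : Omega F → CInf F :=
  fun z => (-π⁻¹) ^ i *
    ∑ h ∈ Finset.range (n + 1), (h.choose i : CInf F) * (c h z * falseE π z ^ (h - i))

/-- The associated polynomial of `∑_h c_h E ^ h`. -/
def eExpPoly (π : CInf F) (n : ℕ) (c : ℕ → Omega F → CInf F) : (Omega F → CInf F)[X] :=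
  ∑ i ∈ Finset.range (n + 1), monomial i (eExpCoeff π n c i)

theorem coeff_eExpPoly (π : CInf F) (n : ℕ) (c : ℕ → Omega F → CInf F) (i : ℕ) :
    (eExpPoly π n c).coeff i = eExpCoeff π n c i := by
  rw [eExpPoly, finsetSum_coeff]
  simp only [coeff_monomial]
  rw [Finset.sum_ite_eq' (Finset.range (n + 1)) i]
  split_ifs with hi
  · rfl
  · ext z
    rw [Finset.mem_range, not_lt] at hi
    rw [eExpCoeff, Finset.sum_eq_zero, mul_zero]
    · rfl
    · intro h hh
      rw [Finset.mem_range] at hh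
      rw [Nat.choose_eq_zero_of_lt (by omega)]
      simp

theorem natDegree_eExpPoly_le (π : CInf F) (n : ℕ) (c : ℕ → Omega F → CInf F) :
    (eExpPoly π n c).natDegree ≤ n := by
  refine natDegree_sum_le_of_forall_le _ _ fun i hi => (natDegree_monomial_le _).trans ?_
  rw [Finset.mem_range] at hi
  omega

section

variable {π : CInf F} {𝔪 : Ideal F[X]} {k m : ℤ} {n : ℕ} {c : ℕ → Omega F → CInf F}

theorem slash_sum_mul_falseE_pow (γ : GL (Fin 2) (RatFunc F)) (z : Omega F) :
    slash k m (fun w => ∑ h ∈ Finset.range (n + 1), c h w * falseE π w ^ h) γ z =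
      ∑ h ∈ Finset.range (n + 1),
        slash (k - 2 * h) (m - h) (c h) γ z * slash 2 1 (falseE π) γ z ^ h := by
  rw [slash_sum]
  refine Finset.sum_congr rfl fun h _ => ?_
  exact slash_mul_pow k m _ _ h (by ring) (by ring) γ z

theorem slash_eExpCoeff (i : ℕ) (γ : GL (Fin 2) (RatFunc F)) (z : Omega F) :
    slash (k - 2 * i) (m - i) (eExpCoeff π n c i) γ z =
      (-π⁻¹) ^ i * ∑ h ∈ Finset.range (n + 1), (h.choose i : CInf F) *
        (slash (k - 2 * h) (m - h) (c h) γ z * slash 2 1 (falseE π) γ z ^ (h - i)) := by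
  unfold eExpCoeff
  rw [slash_const_mul, slash_sum]
  congr 1
  refine Finset.sum_congr rfl fun h _ => ?_
  rw [slash_const_mul]
  rcases le_or_gt i h with hi | hi
  · congr 1
    refine slash_mul_pow _ _ _ _ _ ?_ ?_ γ z
    · push_cast [hi]; ring
    · push_cast [hi]; ring
  · rw [Nat.choose_eq_zero_of_lt hi]
    simp

variable (hc : ∀ h ≤ n, IsModularForm (Gamma0 𝔪) (k - 2 * h) (m - h) (c h))

include hc

theorem memO_eExpCoeff (i : ℕ) : MemO (eExpCoeff π n c i) := by
  constructor
  · refine (IsRigidAnalytic.sum _ _ fun h hh => IsRigidAnalytic.const_mul _ (.mul ?_ ?_)).const_mul _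
    · exact (isModularForm_iff.1 (hc h (by rw [Finset.mem_range] at hh; omega))).1
    · exact (isRigidAnalytic_falseE π).pow _
  · apply IsAPeriodic.isPeriodic
    intro b z
    simp only [eExpCoeff]
    congr 1
    refine Finset.sum_congr rfl fun h hh => ?_
    rw [isAPeriodic_of_slash_eq
      (isModularForm_iff.1 (hc h (by rw [Finset.mem_range] at hh; omega))).2.1 b z,
      isAPeriodic_falseE π b z]

theorem isAssocPoly_eExpPoly :
    IsAssocPoly (Gamma0 𝔪) k m (fun z => ∑ h ∈ Finset.range (n + 1), c h z * falseE π z ^ h)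
      (eExpPoly π n c) := by
  refine ⟨fun i => ?_, fun γ hγ z => ?_⟩
  · rw [coeff_eExpPoly]
    exact memO_eExpCoeff hc i
  · rw [sum_range_coeff_mul (natDegree_eExpPoly_le π n c) (fun i f => f z * kappa γ z ^ i)
      fun i => by simp]
    simp only [coeff_eExpPoly, eExpCoeff]
    rw [sum_binomial_mul_pow n (fun h => c h z), slash_sum_mul_falseE_pow]
    refine Finset.sum_congr rfl fun h hh => ?_
    rw [(isModularForm_iff.1 (hc h (by rw [Finset.mem_range] at hh; omega))).2.1 γ hγ,
      slash_falseE, dslashE_of_mem (Gamma0_le_stabilizerE π 𝔪 hγ), neg_mul, ← sub_eq_add_neg]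

theorem isQuasiModularForm_sum :
    IsQuasiModularForm (Gamma0 𝔪) k m n
      (fun z => ∑ h ∈ Finset.range (n + 1), c h z * falseE π z ^ h) := by
  refine ⟨?_, eExpPoly π n c, isAssocPoly_eExpPoly hc, natDegree_eExpPoly_le π n c, fun i γ => ?_⟩
  · refine IsRigidAnalytic.sum _ _ fun h hh => .mul ?_ ((isRigidAnalytic_falseE π).pow _)
    exact (isModularForm_iff.1 (hc h (by rw [Finset.mem_range] at hh; omega))).1
  · rw [coeff_eExpPoly, show slash _ _ (eExpCoeff π n c i) γ = _ from funext (slash_eExpCoeff i γ)]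
    refine (BoundedOnVerticalLines.sum _ _ fun h hh => .const_mul _ (.mul ?_ ?_)).const_mul _
    · exact (isModularForm_iff.1 (hc h (by rw [Finset.mem_range] at hh; omega))).2.2 γ
    · exact (boundedOnVerticalLines_slash_falseE π γ).pow _

/-- The sign in $-\kappa_\gamma$ turns $E|\gamma-\tilde\pi^{-1}X$ into $E\|\gamma$, so the double
slash acts by substitution. -/
theorem doubleSlash_sum (h𝔪 : 𝔪 ≠ ⊥) (γ : GL (Fin 2) (RatFunc F)) (z : Omega F) :
    doubleSlash (Gamma0 𝔪) k m
        (fun z => ∑ h ∈ Finset.range (n + 1), c h z * falseE π z ^ h) γ z =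
      ∑ h ∈ Finset.range (n + 1), slash (k - 2 * h) (m - h) (c h) γ z * dslashE π γ z ^ h := by
  rw [doubleSlash, (isAssocPoly_eExpPoly hc).assocPoly_eq h𝔪,
    sum_range_coeff_mul (natDegree_eExpPoly_le π n c)
      (fun i f => (-kappa γ z) ^ i * slash (k - 2 * i) (m - i) f γ z)
      fun i => by simp [slash_apply]]
  simp only [coeff_eExpPoly, slash_eExpCoeff]
  have h := sum_binomial_mul_pow n (fun h => slash (k - 2 * h) (m - h) (c h) γ z)
    (slash 2 1 (falseE π) γ z) (-π⁻¹) (-kappa γ z)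
  rw [neg_mul_neg] at h
  rw [show dslashE π γ z = slash 2 1 (falseE π) γ z + π⁻¹ * kappa γ z from rfl, ← h]
  exact Finset.sum_congr rfl fun i _ => mul_comm _ _

/-- The formula for $f_{i,E}$ is $(-\tilde\pi)^i$ times the $i$-th Taylor coefficient of the
associated polynomial at $r=\tilde\pi E$. Shifting by $r$ makes $E-\tilde\pi^{-1}X$ into
$-\tilde\pi^{-1}X$, so only $c_i$ survives. -/
theorem eCoeff_sum (h𝔪 : 𝔪 ≠ ⊥) (hπ : π ≠ 0) {i : ℕ} (hi : i ≤ n) :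
    eCoeff π (Gamma0 𝔪) k m
      (fun z => ∑ h ∈ Finset.range (n + 1), c h z * falseE π z ^ h) i = c i := by
  ext z
  rw [eCoeff, (isAssocPoly_eExpPoly hc).assocPoly_eq h𝔪]
  set p : (CInf F)[X] := ∑ h ∈ Finset.range (n + 1), monomial h (eExpCoeff π n c h z) with hp
  have hp' : p = ∑ h ∈ Finset.range (n + 1), C (c h z) * (C (falseE π z) + C (-π⁻¹) * X) ^ h := by
    refine Polynomial.funext fun x => ?_
    simp only [hp, eval_finsetSum, eval_monomial, eval_mul, eval_C, eval_pow, eval_add, eval_X]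
    rw [← sum_binomial_mul_pow]
    rfl
  set r := π * falseE π z with hr
  have h1 : (taylor r p).coeff i = (-π⁻¹) ^ i * c i z := by
    rw [hp', map_sum, finsetSum_coeff]
    have h2 : ∀ h, (C (c h z) * (C (falseE π z) + C (-π⁻¹) * X) ^ h).comp (X + C r) =
        C ((-π⁻¹) ^ h * c h z) * X ^ h := by
      intro h
      have h3 : C (falseE π z) + C (-π⁻¹) * (X + C r) = C (-π⁻¹) * X := by
        have h4 : falseE π z = π⁻¹ * r := by rw [hr, inv_mul_cancel_left₀ hπ]
        rw [h4, C_mul, C_neg]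
        ring
      simp only [mul_comp, pow_comp, add_comp, C_comp, X_comp]
      rw [h3, mul_pow, C_mul, C_pow]
      ring
    simp only [taylor_apply, h2, coeff_C_mul_X_pow]
    rw [Finset.sum_ite_eq (Finset.range (n + 1)) i, if_pos (by rw [Finset.mem_range]; omega)]
  have h2 : (taylor r p).coeff i =
      ∑ h ∈ Finset.range (n + 1), (h.choose i : CInf F) * eExpCoeff π n c h z * r ^ (h - i) := by
    rw [taylor_coeff, hp, map_sum, eval_finsetSum]
    refine Finset.sum_congr rfl fun h _ => ?_
    rw [hasseDeriv_monomial, eval_monomial]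
  have h3 : ∑ h ∈ Finset.Icc i (eExpPoly π n c).natDegree,
      (h.choose i : CInf F) * (eExpPoly π n c).coeff h z * r ^ (h - i) =
      ∑ h ∈ Finset.range (n + 1), (h.choose i : CInf F) * eExpCoeff π n c h z * r ^ (h - i) := by
    simp only [← coeff_eExpPoly]
    refine Finset.sum_subset (fun h hh => ?_) fun h _ hh => ?_
    · rw [Finset.mem_Icc] at hh
      rw [Finset.mem_range]
      have := natDegree_eExpPoly_le π n c
      omega
    · rw [Finset.mem_Icc, not_and_or, not_le, not_le] at hh
      rcases hh with hh | hh
      · rw [Nat.choose_eq_zero_of_lt hh]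
        simp
      · rw [coeff_eq_zero_of_natDegree_lt hh]
        simp
  rw [h3, ← h2, h1, ← mul_assoc, ← mul_pow, neg_mul_neg, mul_inv_cancel₀ hπ, one_pow, one_mul]

theorem hasEExpansion_sum (h𝔪 : 𝔪 ≠ ⊥) (hπ : π ≠ 0) :
    HasEExpansion π (Gamma0 𝔪) k m n
      (fun z => ∑ h ∈ Finset.range (n + 1), c h z * falseE π z ^ h) c where
  isQuasiModularForm := isQuasiModularForm_sum hc
  coeff_eq _ hi := (eCoeff_sum hc h𝔪 hπ hi).symm
  coeff_isModularForm := hc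
  eq_sum _ := rfl

end

theorem IsModularForm.doubleSlash_eq {𝔪 : Ideal F[X]} (h𝔪 : 𝔪 ≠ ⊥) {k m : ℤ}
    {f : Omega F → CInf F} (hf : IsModularForm (Gamma0 𝔪) k m f) (γ : GL (Fin 2) (RatFunc F))
    (z : Omega F) : doubleSlash (Gamma0 𝔪) k m f γ z = slash k m f γ z := by
  -- In depth $0$ no positive power of $E$ occurs, so the value of the period is irrelevant.
  have h := doubleSlash_sum (π := 0) (n := 0) (c := fun _ => f) (k := k) (m := m) (𝔪 := 𝔪)
    (fun h hh => by
      obtain rfl := Nat.le_zero.1 hh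
      simpa using hf) h𝔪 γ z
  simpa using h

section

variable {π : CInf F} {𝔪 : Ideal F[X]} {k m : ℤ} {n : ℕ} {f : Omega F → CInf F}

theorem mul_falseE_pow_eq_sum (π : CInf F) (f : Omega F → CInf F) (n : ℕ) :
    (fun z => f z * falseE π z ^ n) = fun z => ∑ h ∈ Finset.range (n + 1),
      (if h = n then f else fun _ => 0) z * falseE π z ^ h := by
  ext z
  rw [Finset.sum_eq_single n]
  · rw [if_pos rfl]
  · intro h _ hn
    rw [if_neg hn, zero_mul]
  · simp

theorem IsModularForm.coeff_single (hf : IsModularForm (Gamma0 𝔪) (k - 2 * n) (m - n) f) :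
    ∀ h ≤ n, IsModularForm (Gamma0 𝔪) (k - 2 * h) (m - h) (if h = n then f else fun _ => 0) := by
  intro h _
  split_ifs with hn
  · rw [hn]
    exact hf
  · exact isModularForm_zero _ _ _

theorem IsModularForm.mul_falseE_pow (π : CInf F)
    (hf : IsModularForm (Gamma0 𝔪) (k - 2 * n) (m - n) f) :
    IsQuasiModularForm (Gamma0 𝔪) k m n (fun z => f z * falseE π z ^ n) := by
  rw [mul_falseE_pow_eq_sum]
  exact isQuasiModularForm_sum hf.coeff_single

theorem IsModularForm.doubleSlash_mul_falseE_pow (π : CInf F) (h𝔪 : 𝔪 ≠ ⊥)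
    (hf : IsModularForm (Gamma0 𝔪) (k - 2 * n) (m - n) f) (γ : GL (Fin 2) (RatFunc F))
    (z : Omega F) :
    doubleSlash (Gamma0 𝔪) k m (fun z => f z * falseE π z ^ n) γ z =
      slash (k - 2 * n) (m - n) f γ z * dslashE π γ z ^ n := by
  rw [mul_falseE_pow_eq_sum, doubleSlash_sum hf.coeff_single h𝔪, Finset.sum_eq_single n]
  · rw [if_pos rfl]
  · intro h _ hn
    rw [if_neg hn]
    simp [slash_apply]
  · simp

end

/-! ### Systems of representatives of double cosets -/

theorem IsCosetReps.sum_eq {Γ : Subgroup (GL (Fin 2) (RatFunc F))} {η : GL (Fin 2) (RatFunc F)}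
    {R : Finset (GL (Fin 2) (RatFunc F))} (hR : IsCosetReps Γ η R) {ι : Type*} [Fintype ι]
    (g : ι → GL (Fin 2) (RatFunc F))
    (hg : ∀ i, g i ∈ DoubleCoset.doubleCoset η (Γ : Set (GL (Fin 2) (RatFunc F))) Γ)
    (hg' : ∀ δ ∈ DoubleCoset.doubleCoset η (Γ : Set (GL (Fin 2) (RatFunc F))) Γ,
      ∃! i, δ * (g i)⁻¹ ∈ Γ)
    {M : Type*} [AddCommMonoid M] (φ : GL (Fin 2) (RatFunc F) → M)
    (hφ : ∀ α ∈ Γ, ∀ γ, φ (α * γ) = φ γ) :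
    ∑ r ∈ R, φ r = ∑ i, φ (g i) := by
  choose i hi hi' using fun r : R => hg' r (hR.1 r r.2)
  have hinv : ∀ {x y : GL (Fin 2) (RatFunc F)}, x * y⁻¹ ∈ Γ → y * x⁻¹ ∈ Γ := by
    intro x y h
    simpa using Γ.inv_mem h
  refine Finset.sum_bij (fun r hr => i ⟨r, hr⟩) (fun _ _ => Finset.mem_univ _) ?_ ?_ ?_
  · intro r hr r' hr' h
    have h1 := hi ⟨r, hr⟩
    have h2 := hinv (hi ⟨r', hr'⟩)
    beta_reduce at h1 h2 h
    rw [← h] at h2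
    have h3 := Γ.mul_mem h1 h2
    rw [mul_assoc, inv_mul_cancel_left] at h3
    exact (hR.2 r (hR.1 r hr)).unique ⟨hr, by simp⟩ ⟨hr', h3⟩
  · intro j _
    obtain ⟨r, ⟨hr, h⟩, -⟩ := hR.2 (g j) (hg j)
    exact ⟨r, hr, (hi' ⟨r, hr⟩ j (hinv h)).symm⟩
  · intro r hr
    have h := hφ _ (hinv (hi ⟨r, hr⟩)) r
    rw [inv_mul_cancel_right] at h
    exact h.symm

/-- Right multiplication by $\delta\in\Gamma$ permutes $\Gamma\backslash\Gamma\eta\Gamma$. -/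
theorem IsCosetReps.sum_mul_right {Γ : Subgroup (GL (Fin 2) (RatFunc F))}
    {η : GL (Fin 2) (RatFunc F)} {R : Finset (GL (Fin 2) (RatFunc F))} (hR : IsCosetReps Γ η R)
    {M : Type*} [AddCommMonoid M] (φ : GL (Fin 2) (RatFunc F) → M)
    (hφ : ∀ α ∈ Γ, ∀ γ, φ (α * γ) = φ γ) {δ : GL (Fin 2) (RatFunc F)} (hδ : δ ∈ Γ) :
    ∑ r ∈ R, φ (r * δ) = ∑ r ∈ R, φ r := by
  have hS : ∀ x ∈ DoubleCoset.doubleCoset η (Γ : Set (GL (Fin 2) (RatFunc F))) Γ, ∀ ε ∈ Γ,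
      x * ε ∈ DoubleCoset.doubleCoset η (Γ : Set (GL (Fin 2) (RatFunc F))) Γ := by
    intro x hx ε hε
    obtain ⟨a, ha, b, hb, rfl⟩ := DoubleCoset.mem_doubleCoset.1 hx
    exact DoubleCoset.mem_doubleCoset.2 ⟨a, ha, b * ε, Γ.mul_mem hb hε, by group⟩
  rw [hR.sum_eq (fun r : R => (r : GL (Fin 2) (RatFunc F)) * δ) (fun r => hS _ (hR.1 r r.2) δ hδ)
    ?_ φ hφ, Finset.sum_coe_sort R fun r => φ (r * δ)]
  intro x hx
  obtain ⟨r, ⟨hr, h⟩, hu⟩ := hR.2 _ (hS x hx δ⁻¹ (Γ.inv_mem hδ))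
  refine ⟨⟨r, hr⟩, ?_, fun s hs => Subtype.ext (hu s ⟨s.2, ?_⟩)⟩
  · beta_reduce
    rwa [mul_inv_rev, ← mul_assoc]
  · beta_reduce at hs
    rwa [mul_inv_rev, ← mul_assoc] at hs

variable {ϖ : F[X]} {𝔪 : Ideal F[X]}

theorem coe_diagGL (a d : F[X]) (ha : a ≠ 0) (hd : d ≠ 0) :
    (diagGL a d ha hd : Matrix (Fin 2) (Fin 2) (RatFunc F)) =
      !![algebraMap F[X] (RatFunc F) a, 0; 0, algebraMap F[X] (RatFunc F) d] := rfl

theorem heckeMat_mul_of_dvd (h0 : ϖ ≠ 0) {y : GL (Fin 2) (RatFunc F)} (a b c d : F[X])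
    (hy0 : y 0 0 = algebraMap F[X] (RatFunc F) (ϖ * a))
    (hy1 : y 0 1 = algebraMap F[X] (RatFunc F) b) (hy2 : y 1 0 = algebraMap F[X] (RatFunc F) c)
    (hy3 : y 1 1 = algebraMap F[X] (RatFunc F) d) (h : a * (ϖ * d) - b * c ≠ 0) :
    heckeMat ϖ h0 * y = matA a b c (ϖ * d) h * diagGL ϖ 1 h0 one_ne_zero := by
  apply Units.ext
  ext i j
  fin_cases i <;> fin_cases j <;>
    simp [heckeMat, coe_diagGL, coe_matA, Matrix.mul_apply, Fin.sum_univ_two, hy0, hy1, hy2, hy3,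
      mul_comm]

theorem heckeMat_mul_of_eq (h0 : ϖ ≠ 0) {y : GL (Fin 2) (RatFunc F)} (a c d s t : F[X])
    (hy0 : y 0 0 = algebraMap F[X] (RatFunc F) a)
    (hy1 : y 0 1 = algebraMap F[X] (RatFunc F) (a * s + ϖ * t))
    (hy2 : y 1 0 = algebraMap F[X] (RatFunc F) c)
    (hy3 : y 1 1 = algebraMap F[X] (RatFunc F) d) (h : a * (d - c * s) - t * (ϖ * c) ≠ 0) :
    heckeMat ϖ h0 * y = matA a t (ϖ * c) (d - c * s) h * (heckeMat ϖ h0 * transMat s) := by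
  apply Units.ext
  ext i j
  fin_cases i <;> fin_cases j <;>
    simp [heckeMat, transMat, coe_diagGL, coe_matA, Matrix.mul_apply, Fin.sum_univ_two, hy0, hy1,
      hy2, hy3, Algebra.smul_def] <;> ring

/-- Push $\eta$ through $y=(a\ b;\ c\ d)$: if $\wp\mid a$, this leads to $\mathrm{diag}(\wp,1)$.
Otherwise $b\equiv as\pmod\wp$ is solvable and leads to $\eta$ times a translation. -/
theorem exists_of_mem_doubleCoset (hirr : Irreducible ϖ) {δ : GL (Fin 2) (RatFunc F)}
    (hδ : δ ∈ DoubleCoset.doubleCoset (heckeMat ϖ hirr.ne_zero)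
      (Gamma0 𝔪 : Set (GL (Fin 2) (RatFunc F))) (Gamma0 𝔪)) :
    (∃ α ∈ Gamma0 𝔪, δ = α * diagGL ϖ 1 hirr.ne_zero one_ne_zero) ∨
      ∃ α ∈ Gamma0 𝔪, ∃ s, δ = α * (heckeMat ϖ hirr.ne_zero * transMat s) := by
  obtain ⟨x, hx, y, hy, rfl⟩ := DoubleCoset.mem_doubleCoset.1 hδ
  obtain ⟨a, b, c, d, ha, hb, hc, hd, hm, hu⟩ := mem_Gamma0_iff.1 hy
  by_cases hdvd : ϖ ∣ a
  · left
    obtain ⟨a, rfl⟩ := hdvd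
    have e : a * (ϖ * d) - b * c = ϖ * a * d - b * c := by ring
    refine ⟨_, (Gamma0 𝔪).mul_mem hx (matA_mem_Gamma0 a b c (ϖ * d) (e ▸ hu.ne_zero) (e ▸ hu) hm),
      ?_⟩
    rw [mul_assoc, mul_assoc, heckeMat_mul_of_dvd hirr.ne_zero a b c d ha hb hc hd]
  · right
    obtain ⟨u, v, huv⟩ := (hirr.coprime_iff_not_dvd.2 hdvd : IsCoprime ϖ a)
    have hb' : b = a * (v * b) + ϖ * (u * b) := by linear_combination (-b) * huv
    have e : a * (d - c * (v * b)) - u * b * (ϖ * c) = a * d - b * c := by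
      linear_combination (-(b * c)) * huv
    refine ⟨_, (Gamma0 𝔪).mul_mem hx (matA_mem_Gamma0 a (u * b) (ϖ * c) (d - c * (v * b))
      (e ▸ hu.ne_zero) (e ▸ hu) (𝔪.mul_mem_left _ hm)), v * b, ?_⟩
    rw [mul_assoc, mul_assoc, heckeMat_mul_of_eq hirr.ne_zero a c d (v * b) (u * b) ha
      (hb' ▸ hb) hc hd]

/-- Here $\mathfrak p\nmid\mathfrak m$ enters: a $\mu\in\mathfrak m$ prime to $\wp$ is the lower
left entry of a determinant one matrix whose upper left entry is $\wp$. -/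
theorem diagGL_mem_doubleCoset (hirr : Irreducible ϖ) (hndvd : ¬ Ideal.span {ϖ} ∣ 𝔪) :
    diagGL ϖ 1 hirr.ne_zero one_ne_zero ∈ DoubleCoset.doubleCoset (heckeMat ϖ hirr.ne_zero)
      (Gamma0 𝔪 : Set (GL (Fin 2) (RatFunc F))) (Gamma0 𝔪) := by
  rw [Ideal.dvd_iff_le, SetLike.not_le_iff_exists] at hndvd
  obtain ⟨μ, hμ, hμ'⟩ := hndvd
  rw [Ideal.mem_span_singleton] at hμ'
  obtain ⟨u, v, huv⟩ := (hirr.coprime_iff_not_dvd.2 hμ' : IsCoprime ϖ μ)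
  have e : ϖ * u - -v * μ = 1 := by linear_combination huv
  have e' : 1 * (ϖ * u) - -v * μ = 1 := by linear_combination huv
  have h := heckeMat_mul_of_dvd hirr.ne_zero (y := matA ϖ (-v) μ u (by rw [e]; exact one_ne_zero))
    1 (-v) μ u (by rw [mul_one]; rfl) rfl rfl rfl (by rw [e']; exact one_ne_zero)
  refine DoubleCoset.mem_doubleCoset.2 ⟨(matA 1 (-v) μ (ϖ * u) (by rw [e']; exact one_ne_zero))⁻¹,
    (Gamma0 𝔪).inv_mem (matA_mem_Gamma0 _ _ _ _ _ (by rw [e']; exact isUnit_one) hμ), _,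
    matA_mem_Gamma0 ϖ (-v) μ u (by rw [e]; exact one_ne_zero) (by rw [e]; exact isUnit_one) hμ, ?_⟩
  rw [mul_assoc, h, inv_mul_cancel_left]

theorem heckeMat_mul_transMat_mem (h0 : ϖ ≠ 0) (s : F[X]) :
    heckeMat ϖ h0 * transMat s ∈ DoubleCoset.doubleCoset (heckeMat ϖ h0)
      (Gamma0 𝔪 : Set (GL (Fin 2) (RatFunc F))) (Gamma0 𝔪) :=
  DoubleCoset.mem_doubleCoset.2 ⟨1, (Gamma0 𝔪).one_mem, _, transMat_mem_Gamma0 𝔪 s, by simp⟩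

/-- Inequivalent representatives for $U_{\mathfrak p}$ stay inequivalent under the larger group.
Conjugation by $\eta$ multiplies the lower left entry by $\wp$, and that entry of $yy'^{-1}$ was
already in $\mathfrak m\mathfrak p$. -/
theorem mul_inv_mem_of_mem_doubleCoset (h0 : ϖ ≠ 0) {r r' : GL (Fin 2) (RatFunc F)}
    (hr : r ∈ DoubleCoset.doubleCoset (heckeMat ϖ h0)
      (Gamma0 (𝔪 * Ideal.span {ϖ}) : Set (GL (Fin 2) (RatFunc F))) (Gamma0 (𝔪 * Ideal.span {ϖ})))
    (hr' : r' ∈ DoubleCoset.doubleCoset (heckeMat ϖ h0)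
      (Gamma0 (𝔪 * Ideal.span {ϖ}) : Set (GL (Fin 2) (RatFunc F))) (Gamma0 (𝔪 * Ideal.span {ϖ})))
    (h : r * r'⁻¹ ∈ Gamma0 𝔪) : r * r'⁻¹ ∈ Gamma0 (𝔪 * Ideal.span {ϖ}) := by
  obtain ⟨x, hx, y, hy, rfl⟩ := DoubleCoset.mem_doubleCoset.1 hr
  obtain ⟨x', hx', y', hy', rfl⟩ := DoubleCoset.mem_doubleCoset.1 hr'
  set Γ := Gamma0 (𝔪 * Ideal.span {ϖ}) with hΓ
  have hle : Γ ≤ Gamma0 𝔪 := Gamma0_mono Ideal.mul_le_left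
  set β := heckeMat ϖ h0 * (y * y'⁻¹) * (heckeMat ϖ h0)⁻¹ with hβ
  have e : x * heckeMat ϖ h0 * y * (x' * heckeMat ϖ h0 * y')⁻¹ = x * β * x'⁻¹ := by
    rw [hβ]; group
  rw [e] at h ⊢
  rw [Subgroup.mul_mem_cancel_right _ (Subgroup.inv_mem _ (hle hx')),
    Subgroup.mul_mem_cancel_left _ (hle hx)] at h
  rw [Subgroup.mul_mem_cancel_right _ (Subgroup.inv_mem _ hx'), Subgroup.mul_mem_cancel_left _ hx]
  obtain ⟨a, b, c, d, ha, hb, hc, hd, hm, hu⟩ := mem_Gamma0_iff.1 h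
  obtain ⟨p, q, s, t, hp, hq, hs, ht, hm', -⟩ := mem_Gamma0_iff.1 (Γ.mul_mem hy (Γ.inv_mem hy'))
  refine mem_Gamma0_iff.2 ⟨a, b, c, d, ha, hb, hc, hd, ?_, hu⟩
  have h1 : β * heckeMat ϖ h0 = heckeMat ϖ h0 * (y * y'⁻¹) := by rw [hβ, inv_mul_cancel_right]
  have h2 := congrArg (fun g : GL (Fin 2) (RatFunc F) => g 1 0) h1
  simp only [Units.val_mul β, Units.val_mul (heckeMat ϖ h0), Matrix.mul_apply (M := β.val),
    Matrix.mul_apply (M := (heckeMat ϖ h0).val), Fin.sum_univ_two] at h2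
  rw [hs, hc] at h2
  simp only [heckeMat, coe_diagGL] at h2
  simp only [Matrix.of_apply, Matrix.cons_val', Matrix.cons_val_zero, Matrix.cons_val_one,
    Matrix.cons_val_fin_one, map_one, mul_one, mul_zero, zero_mul, zero_add, add_zero,
    ← map_mul] at h2
  rw [RatFunc.algebraMap_injective F h2]
  exact Ideal.mul_mem_left _ _ hm'

/-- Otherwise $\wp$ would divide both entries of the bottom row of $y^{-1}$: the left one by the
level, the right one by comparing lower right entries. But its determinant is a unit. -/
theorem diagGL_mul_inv_notMem (hirr : Irreducible ϖ) {r : GL (Fin 2) (RatFunc F)}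
    (hr : r ∈ DoubleCoset.doubleCoset (heckeMat ϖ hirr.ne_zero)
      (Gamma0 (𝔪 * Ideal.span {ϖ}) : Set (GL (Fin 2) (RatFunc F))) (Gamma0 (𝔪 * Ideal.span {ϖ}))) :
    diagGL ϖ 1 hirr.ne_zero one_ne_zero * r⁻¹ ∉ Gamma0 𝔪 := by
  intro h
  obtain ⟨x, hx, y, hy, rfl⟩ := DoubleCoset.mem_doubleCoset.1 hr
  set Γ := Gamma0 (𝔪 * Ideal.span {ϖ}) with hΓ
  set η := heckeMat ϖ hirr.ne_zero with hη
  have hle : Γ ≤ Gamma0 𝔪 := Gamma0_mono Ideal.mul_le_left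
  obtain ⟨a, b, c, d, -, -, -, hd, -, -⟩ := mem_Gamma0_iff.1 ((Gamma0 𝔪).mul_mem h (hle hx))
  obtain ⟨p, q, s, t, hp, hq, hs, ht, hm', hu⟩ := mem_Gamma0_iff.1 (Γ.inv_mem hy)
  have h1 : diagGL ϖ 1 hirr.ne_zero one_ne_zero * y⁻¹ =
      diagGL ϖ 1 hirr.ne_zero one_ne_zero * (x * η * y)⁻¹ * x * η := by group
  have h2 := congrArg (fun g : GL (Fin 2) (RatFunc F) => g 1 1) h1
  beta_reduce at h2
  rw [Units.val_mul, Units.val_mul _ η, Matrix.mul_apply, Matrix.mul_apply, Fin.sum_univ_two,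
    Fin.sum_univ_two, hd, ht] at h2
  simp only [hη, heckeMat, coe_diagGL] at h2
  simp only [Matrix.of_apply, Matrix.cons_val', Matrix.cons_val_zero, Matrix.cons_val_one,
    Matrix.cons_val_fin_one, map_one, one_mul, mul_zero, zero_mul, zero_add,
    ← map_mul] at h2
  have ht' : ϖ ∣ t := ⟨d, by rw [RatFunc.algebraMap_injective F h2, mul_comm]⟩
  have hs' : ϖ ∣ s := Ideal.mem_span_singleton.1 (Ideal.mul_le_right hm')
  exact hirr.not_isUnit (isUnit_of_dvd_unit
    (dvd_sub (Dvd.dvd.mul_left ht' p) (Dvd.dvd.mul_left hs' q)) hu)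

theorem IsCosetReps.sum_eq_add_sum (hirr : Irreducible ϖ) (hndvd : ¬ Ideal.span {ϖ} ∣ 𝔪)
    {RT RU : Finset (GL (Fin 2) (RatFunc F))}
    (hRT : IsCosetReps (Gamma0 𝔪) (heckeMat ϖ hirr.ne_zero) RT)
    (hRU : IsCosetReps (Gamma0 (𝔪 * Ideal.span {ϖ})) (heckeMat ϖ hirr.ne_zero) RU)
    {M : Type*} [AddCommMonoid M] (φ : GL (Fin 2) (RatFunc F) → M)
    (hφ : ∀ α ∈ Gamma0 𝔪, ∀ γ, φ (α * γ) = φ γ) :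
    ∑ r ∈ RT, φ r = φ (diagGL ϖ 1 hirr.ne_zero one_ne_zero) + ∑ r ∈ RU, φ r := by
  have hle : Gamma0 (𝔪 * Ideal.span {ϖ}) ≤ Gamma0 𝔪 := Gamma0_mono Ideal.mul_le_left
  -- `none` stands for the extra coset, that of $\mathrm{diag}(\wp,1)$.
  set g : Option RU → GL (Fin 2) (RatFunc F) := fun i =>
    i.elim (diagGL ϖ 1 hirr.ne_zero one_ne_zero) fun r => r with hg
  rw [hRT.sum_eq g ?_ ?_ φ hφ, Fintype.sum_option]
  · congr 1
    exact Finset.sum_coe_sort RU φ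
  · rintro (_ | r)
    · exact diagGL_mem_doubleCoset hirr hndvd
    · obtain ⟨x, hx, y, hy, h⟩ := DoubleCoset.mem_doubleCoset.1 (hRU.1 r r.2)
      exact DoubleCoset.mem_doubleCoset.2 ⟨x, hle hx, y, hle hy, h⟩
  · intro δ hδ
    have huniq : ∀ i j, g i * (g j)⁻¹ ∈ Gamma0 𝔪 → i = j := by
      rintro (_ | r) (_ | r') h
      · rfl
      · exact absurd h (diagGL_mul_inv_notMem hirr (hRU.1 r' r'.2))
      · refine absurd ?_ (diagGL_mul_inv_notMem (𝔪 := 𝔪) hirr (hRU.1 r r.2))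
        have h' := (Gamma0 𝔪).inv_mem h
        rwa [mul_inv_rev, inv_inv] at h'
      · have h' := mul_inv_mem_of_mem_doubleCoset hirr.ne_zero (hRU.1 r r.2) (hRU.1 r' r'.2) h
        exact congrArg some (Subtype.ext ((hRU.2 r (hRU.1 r r.2)).unique
          ⟨r.2, by simp [(Gamma0 _).one_mem]⟩ ⟨r'.2, h'⟩))
    refine existsUnique_of_exists_of_unique ?_ fun i j hi hj => huniq i j ?_
    · rcases exists_of_mem_doubleCoset hirr hδ with ⟨α, hα, rfl⟩ | ⟨α, hα, s, rfl⟩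
      · exact ⟨none, by simpa [hg] using hα⟩
      · obtain ⟨r, ⟨hr, h⟩, -⟩ := hRU.2 _ (heckeMat_mul_transMat_mem hirr.ne_zero s)
        refine ⟨some ⟨r, hr⟩, ?_⟩
        rw [mul_assoc]
        exact (Gamma0 𝔪).mul_mem hα (hle h)
    · have h := (Gamma0 𝔪).mul_mem ((Gamma0 𝔪).inv_mem hi) hj
      rwa [mul_inv_rev, inv_inv, mul_assoc, inv_mul_cancel_left] at h

/-! ### The stabilization `E_𝔭` -/

theorem detC_diagGL (a d : F[X]) (ha : a ≠ 0) (hd : d ≠ 0) :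
    detC (diagGL a d ha hd) = embA a * embA d := by
  rw [detC_eq]
  simp [coe_diagGL, embK_algebraMap]

theorem denom_diagGL (a d : F[X]) (ha : a ≠ 0) (hd : d ≠ 0) (z : Omega F) :
    denom (diagGL a d ha hd) z = embA d := by
  rw [denom]
  simp [coe_diagGL, embK_algebraMap]

theorem slash_diagGL (k m : ℤ) (f : Omega F → CInf F) (h0 : ϖ ≠ 0) (z : Omega F) :
    slash k m f (diagGL ϖ 1 h0 one_ne_zero) z = embA ϖ ^ m * degeneracy ϖ h0 f z := by
  rw [slash_apply, detC_diagGL, denom_diagGL, map_one, one_zpow, mul_one, mul_one]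
  rfl

theorem dslashE_diagGL (π : CInf F) (h0 : ϖ ≠ 0) (z : Omega F) :
    dslashE π (diagGL ϖ 1 h0 one_ne_zero) z = falseE π z - stabE π ϖ h0 z := by
  rw [dslashE, kappa_eq_zero (by simp [coe_diagGL]), slash_diagGL, stabE, zpow_one]
  ring

/-- $E_{\mathfrak p}=E-E\|\mathrm{diag}(\wp,1)$, and the $\kappa$-terms cancel in the difference. -/
theorem slash_stabE (π : CInf F) (h0 : ϖ ≠ 0) (γ : GL (Fin 2) (RatFunc F)) (z : Omega F) :
    slash 2 1 (stabE π ϖ h0) γ z =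
      dslashE π γ z - dslashE π (diagGL ϖ 1 h0 one_ne_zero * γ) z := by
  have h : stabE π ϖ h0 =
      fun w => falseE π w + -1 * dslashE π (diagGL ϖ 1 h0 one_ne_zero) w := by
    ext w
    rw [dslashE_diagGL]
    ring
  rw [h, slash_add, slash_const_mul, dslashE_mul, slash_falseE]
  ring

theorem exists_diagGL_mul_eq (h0 : ϖ ≠ 0) {γ : GL (Fin 2) (RatFunc F)}
    (hγ : γ ∈ Gamma0 (𝔪 * Ideal.span {ϖ})) : ∃ γ' ∈ Gamma0 (⊤ : Ideal F[X]),
      diagGL ϖ 1 h0 one_ne_zero * γ = γ' * diagGL ϖ 1 h0 one_ne_zero := by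
  obtain ⟨a, b, c, d, ha, hb, hc, hd, hm, hu⟩ := mem_Gamma0_iff.1 hγ
  obtain ⟨c, rfl⟩ := Ideal.mem_span_singleton.1 (Ideal.mul_le_right hm)
  have e : a * d - ϖ * b * c = a * d - b * (ϖ * c) := by ring
  have hu' : IsUnit (a * d - ϖ * b * c) := by rwa [e]
  refine ⟨matA a (ϖ * b) c d hu'.ne_zero,
    matA_mem_Gamma0 _ _ _ _ _ hu' Submodule.mem_top, ?_⟩
  apply Units.ext
  ext i j
  fin_cases i <;> fin_cases j <;>
    simp [coe_diagGL, coe_matA, Matrix.mul_apply, Fin.sum_univ_two, ha, hb, hc, hd, mul_comm]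

/-- The product is the scalar $\wp$, on which $\det\cdot(cz+d)^{-2}=1$. -/
theorem diagGL_mul_heckeMat_mem_stabilizerE (π : CInf F) (h0 : ϖ ≠ 0) :
    diagGL ϖ 1 h0 one_ne_zero * heckeMat ϖ h0 ∈ stabilizerE π := by
  set γ := diagGL ϖ 1 h0 one_ne_zero * heckeMat ϖ h0 with hγ
  have hϖ : (embA ϖ : CInf F) ≠ 0 := embA_ne_zero h0
  have hdet : detC γ = embA ϖ * embA ϖ := by
    rw [hγ, detC_mul, heckeMat, detC_diagGL, detC_diagGL, map_one, mul_one, one_mul]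
  have hden : ∀ z : Omega F, denom γ z = embA ϖ := by
    intro z
    rw [hγ, denom_mul, heckeMat, denom_diagGL, denom_diagGL, map_one, one_mul]
  have h00 : γ 0 0 = algebraMap F[X] (RatFunc F) ϖ := by
    simp [hγ, heckeMat, coe_diagGL, Matrix.mul_apply, Fin.sum_univ_two]
  have h01 : γ 0 1 = 0 := by
    simp [hγ, heckeMat, coe_diagGL, Matrix.mul_apply, Fin.sum_univ_two]
  have h10 : γ 1 0 = 0 := by
    simp [hγ, heckeMat, coe_diagGL, Matrix.mul_apply, Fin.sum_univ_two]
  have hmob : ∀ z : Omega F, mob γ z = z := by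
    intro z
    apply Subtype.ext
    rw [coe_mob, hden, h00, h01, embK_algebraMap, map_zero, add_zero, mul_div_cancel_left₀ _ hϖ]
  change dslashE π γ = falseE π
  ext z
  rw [dslashE, kappa_eq_zero h10, mul_zero, add_zero, slash_apply, hdet, hden, hmob, zpow_one,
    zpow_neg]
  have e2 : (embA ϖ : CInf F) ^ (2 : ℤ) = embA ϖ * embA ϖ := by rw [zpow_two]
  rw [e2, mul_inv_cancel₀ (mul_ne_zero hϖ hϖ), one_mul]

theorem slash_stabE_of_mem (π : CInf F) (h0 : ϖ ≠ 0) {γ : GL (Fin 2) (RatFunc F)}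
    (hγ : γ ∈ Gamma0 (𝔪 * Ideal.span {ϖ})) : slash 2 1 (stabE π ϖ h0) γ = stabE π ϖ h0 := by
  ext z
  obtain ⟨γ', hγ', h⟩ := exists_diagGL_mul_eq h0 hγ
  rw [slash_stabE, h, dslashE_mul_of_mem (Gamma0_le_stabilizerE π _ hγ'),
    dslashE_of_mem (Gamma0_le_stabilizerE π _ hγ), dslashE_diagGL, sub_sub_cancel]

/-- For $\gamma=x\eta y$, $\mathrm{diag}(\wp,1)\gamma=x'\cdot\wp\cdot y$ with $x'\in GL_2(A)$, and
all three factors fix $E$. So the second term of `slash_stabE` is $E$. -/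
theorem slash_stabE_of_mem_doubleCoset (π : CInf F) (h0 : ϖ ≠ 0) {γ : GL (Fin 2) (RatFunc F)}
    (hγ : γ ∈ DoubleCoset.doubleCoset (heckeMat ϖ h0)
      (Gamma0 (𝔪 * Ideal.span {ϖ}) : Set (GL (Fin 2) (RatFunc F)))
      (Gamma0 (𝔪 * Ideal.span {ϖ}))) (z : Omega F) :
    slash 2 1 (stabE π ϖ h0) γ z = dslashE π γ z - falseE π z := by
  obtain ⟨x, hx, y, hy, rfl⟩ := DoubleCoset.mem_doubleCoset.1 hγ
  obtain ⟨x', hx', h⟩ := exists_diagGL_mul_eq h0 hx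
  have h' : diagGL ϖ 1 h0 one_ne_zero * (x * heckeMat ϖ h0 * y) =
      x' * (diagGL ϖ 1 h0 one_ne_zero * heckeMat ϖ h0 * y) := by
    rw [mul_assoc x, ← mul_assoc, h]
    group
  rw [slash_stabE, h', dslashE_mul_of_mem (Gamma0_le_stabilizerE π _ hx'),
    dslashE_mul_of_mem (diagGL_mul_heckeMat_mem_stabilizerE π h0),
    dslashE_of_mem (Gamma0_le_stabilizerE π _ hy)]

theorem isRigidAnalytic_stabE (π : CInf F) (h0 : ϖ ≠ 0) : IsRigidAnalytic (stabE π ϖ h0) :=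
  (isRigidAnalytic_falseE π).sub (((isRigidAnalytic_falseE π).comp_mob _).const_mul _)

theorem boundedOnVerticalLines_slash_stabE (π : CInf F) (h0 : ϖ ≠ 0)
    (γ : GL (Fin 2) (RatFunc F)) : BoundedOnVerticalLines (slash 2 1 (stabE π ϖ h0) γ) := by
  rw [show slash 2 1 (stabE π ϖ h0) γ = _ from funext (slash_stabE π h0 γ)]
  exact (boundedOnVerticalLines_dslashE π _).sub (boundedOnVerticalLines_dslashE π _)

section

variable {k m : ℤ} {n h : ℕ} {f : Omega F → CInf F}

theorem slash_mul_pow_sub (hn : h ≤ n) (f g : Omega F → CInf F) (γ : GL (Fin 2) (RatFunc F))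
    (z : Omega F) :
    slash (k - 2 * h) (m - h) (fun w => f w * g w ^ (n - h)) γ z =
      slash (k - 2 * n) (m - n) f γ z * slash 2 1 g γ z ^ (n - h) := by
  refine slash_mul_pow _ _ f g _ ?_ ?_ γ z
  · push_cast [hn]; ring
  · push_cast [hn]; ring

theorem IsModularForm.mul_stabE_pow (π : CInf F) (h0 : ϖ ≠ 0)
    (hf : IsModularForm (Gamma0 𝔪) (k - 2 * n) (m - n) f) (hn : h ≤ n) :
    IsModularForm (Gamma0 (𝔪 * Ideal.span {ϖ})) (k - 2 * h) (m - h)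
      (fun z => f z * stabE π ϖ h0 z ^ (n - h)) := by
  obtain ⟨hr, hs, hb⟩ := isModularForm_iff.1 hf
  refine isModularForm_iff.2 ⟨hr.mul ((isRigidAnalytic_stabE π h0).pow _), fun γ hγ => ?_,
    fun γ => ?_⟩
  · ext z
    have hle : Gamma0 (𝔪 * Ideal.span {ϖ}) ≤ Gamma0 𝔪 := Gamma0_mono Ideal.mul_le_left
    rw [slash_mul_pow_sub hn f (stabE π ϖ h0), hs γ (hle hγ), slash_stabE_of_mem π h0 hγ]
  · have h1 : slash (k - 2 * h) (m - h) (fun z => f z * stabE π ϖ h0 z ^ (n - h)) γ = fun z =>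
        slash (k - 2 * n) (m - n) f γ z * slash 2 1 (stabE π ϖ h0) γ z ^ (n - h) :=
      funext (slash_mul_pow_sub hn f (stabE π ϖ h0) γ)
    rw [h1]
    exact (hb γ).mul ((boundedOnVerticalLines_slash_stabE π h0 γ).pow _)

/-! ### The coefficients of the `E`-expansion of `T_𝔭(f E ^ n)` -/

/-- The contribution of `γ` to the coefficient of `E ^ h` in `T_𝔭(f E ^ n)`. -/
def heckeTerm (π : CInf F) (k m : ℤ) (n h : ℕ) (f : Omega F → CInf F)
    (γ : GL (Fin 2) (RatFunc F)) : Omega F → CInf F :=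
  fun z => slash (k - 2 * n) (m - n) f γ z * (dslashE π γ z - falseE π z) ^ (n - h)

theorem heckeTerm_mul_left {π : CInf F}
    (hs : ∀ γ ∈ Gamma0 𝔪, slash (k - 2 * n) (m - n) f γ = f) {α : GL (Fin 2) (RatFunc F)}
    (hα : α ∈ Gamma0 𝔪) (γ : GL (Fin 2) (RatFunc F)) :
    heckeTerm π k m n h f (α * γ) = heckeTerm π k m n h f γ := by
  ext z
  rw [heckeTerm, slash_mul_right, hs α hα, dslashE_mul_of_mem (Gamma0_le_stabilizerE π _ hα)]
  rfl

theorem slash_heckeTerm {π : CInf F} (hn : h ≤ n) (γ δ : GL (Fin 2) (RatFunc F)) (z : Omega F) :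
    slash (k - 2 * h) (m - h) (heckeTerm π k m n h f γ) δ z =
      slash (k - 2 * n) (m - n) f (γ * δ) z *
        (dslashE π (γ * δ) z - dslashE π δ z) ^ (n - h) := by
  unfold heckeTerm
  rw [slash_mul_pow_sub hn, slash_mul_right, dslashE_mul]
  congr 2
  have h1 := slash_add 2 1 (dslashE π γ) (fun w => -1 * falseE π w) δ z
  rw [slash_const_mul, slash_falseE] at h1
  simp only [neg_one_mul, ← sub_eq_add_neg] at h1
  rw [h1]
  ring

/-- By `slash_heckeTerm`, slashing by $\delta$ replaces $\gamma$ by $\gamma\delta$ and $E$ by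
$E\|\delta$. For $\delta\in\Gamma_0(\mathfrak m)$ the latter is $E$ and the cosets are permuted. For
general $\delta$ every factor is bounded. -/
theorem isModularForm_sum_heckeTerm (π : CInf F) {η : GL (Fin 2) (RatFunc F)}
    {R : Finset (GL (Fin 2) (RatFunc F))} (hR : IsCosetReps (Gamma0 𝔪) η R)
    (hf : IsModularForm (Gamma0 𝔪) (k - 2 * n) (m - n) f) (hn : h ≤ n) (c : CInf F) :
    IsModularForm (Gamma0 𝔪) (k - 2 * h) (m - h)
      (fun z => c * ∑ γ ∈ R, heckeTerm π k m n h f γ z) := by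
  obtain ⟨hr, hs, hb⟩ := isModularForm_iff.1 hf
  refine isModularForm_iff.2 ⟨?_, fun δ hδ => ?_, fun δ => ?_⟩
  · refine (IsRigidAnalytic.sum _ _ fun γ _ => (hr.slash _ _ γ).mul (.pow ?_ _)).const_mul _
    exact (isRigidAnalytic_dslashE π γ).sub (isRigidAnalytic_falseE π)
  · ext z
    rw [slash_const_mul, slash_sum]
    simp only [slash_heckeTerm hn, dslashE_of_mem (Gamma0_le_stabilizerE π _ hδ)]
    rw [← hR.sum_mul_right (fun γ => heckeTerm π k m n h f γ z)
      (fun α hα γ => by rw [heckeTerm_mul_left hs hα]) hδ]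
    rfl
  · have h1 : slash (k - 2 * h) (m - h) (fun z => c * ∑ γ ∈ R, heckeTerm π k m n h f γ z) δ =
        fun z => c * ∑ γ ∈ R, slash (k - 2 * n) (m - n) f (γ * δ) z *
          (dslashE π (γ * δ) z - dslashE π δ z) ^ (n - h) := by
      ext z
      rw [slash_const_mul, slash_sum]
      simp only [slash_heckeTerm hn]
    rw [h1]
    refine (BoundedOnVerticalLines.sum _ _ fun γ _ => (hb _).mul (.pow ?_ _)).const_mul _
    exact (boundedOnVerticalLines_dslashE π _).sub (boundedOnVerticalLines_dslashE π _)

theorem hecke_mul_falseE_pow (π : CInf F) (h𝔪 : 𝔪 ≠ ⊥)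
    (hf : IsModularForm (Gamma0 𝔪) (k - 2 * n) (m - n) f) (η : GL (Fin 2) (RatFunc F))
    (R : Finset (GL (Fin 2) (RatFunc F))) :
    hecke (Gamma0 𝔪) η R k m (fun z => f z * falseE π z ^ n) = fun z =>
      ∑ h ∈ Finset.range (n + 1), (n.choose h : CInf F) * detC η ^ (k - m) *
        (∑ γ ∈ R, heckeTerm π k m n h f γ z) * falseE π z ^ h := by
  ext z
  rw [hecke, Finset.mul_sum]
  simp only [hf.doubleSlash_mul_falseE_pow π h𝔪, Finset.mul_sum, Finset.sum_mul]
  rw [Finset.sum_comm]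
  refine Finset.sum_congr rfl fun γ _ => ?_
  have h1 : dslashE π γ z = falseE π z + (dslashE π γ z - falseE π z) := by ring
  rw [h1, add_pow, Finset.mul_sum, Finset.mul_sum]
  refine Finset.sum_congr rfl fun i _ => ?_
  rw [heckeTerm, detC]
  ring

theorem sum_heckeTerm_eq (π : CInf F) (h𝔪 : 𝔪 ≠ ⊥) (hirr : Irreducible ϖ)
    (hndvd : ¬ Ideal.span {ϖ} ∣ 𝔪)
    (hf : IsModularForm (Gamma0 𝔪) (k - 2 * n) (m - n) f)
    {RT RU : Finset (GL (Fin 2) (RatFunc F))}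
    (hRT : IsCosetReps (Gamma0 𝔪) (heckeMat ϖ hirr.ne_zero) RT)
    (hRU : IsCosetReps (Gamma0 (𝔪 * Ideal.span {ϖ})) (heckeMat ϖ hirr.ne_zero) RU) (hn : h ≤ n)
    (z : Omega F) :
    embA ϖ ^ (k - m) * ∑ γ ∈ RT, heckeTerm π k m n h f γ z = embA ϖ ^ h *
        (embA ϖ ^ (k - n - h) * degeneracy ϖ hirr.ne_zero f z *
            (-stabE π ϖ hirr.ne_zero z) ^ (n - h) +
          hecke (Gamma0 (𝔪 * Ideal.span {ϖ})) (heckeMat ϖ hirr.ne_zero) RU (k - 2 * h) (m - h)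
            (fun w => f w * stabE π ϖ hirr.ne_zero w ^ (n - h)) z) := by
  have hϖ : (embA ϖ : CInf F) ≠ 0 := embA_ne_zero hirr.ne_zero
  have h𝔪' : 𝔪 * Ideal.span {ϖ} ≠ ⊥ :=
    mul_ne_zero h𝔪 (by simpa using hirr.ne_zero)
  rw [hRT.sum_eq_add_sum hirr hndvd hRU (fun γ => heckeTerm π k m n h f γ z)
    fun α hα γ => by rw [heckeTerm_mul_left (isModularForm_iff.1 hf).2.1 hα]]
  have h1 : heckeTerm π k m n h f (diagGL ϖ 1 hirr.ne_zero one_ne_zero) z =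
      embA ϖ ^ (m - n) * degeneracy ϖ hirr.ne_zero f z *
        (-stabE π ϖ hirr.ne_zero z) ^ (n - h) := by
    rw [heckeTerm, slash_diagGL, dslashE_diagGL, sub_sub_cancel_left]
  have h2 : ∀ γ ∈ RU, heckeTerm π k m n h f γ z =
      doubleSlash (Gamma0 (𝔪 * Ideal.span {ϖ})) (k - 2 * h) (m - h)
        (fun w => f w * stabE π ϖ hirr.ne_zero w ^ (n - h)) γ z := by
    intro γ hγ
    rw [(hf.mul_stabE_pow π hirr.ne_zero hn).doubleSlash_eq h𝔪', slash_mul_pow_sub hn,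
      slash_stabE_of_mem_doubleCoset π hirr.ne_zero (hRU.1 γ hγ)]
    rfl
  have h3 : embK (heckeMat ϖ hirr.ne_zero : Matrix (Fin 2) (Fin 2) (RatFunc F)).det =
      (embA ϖ : CInf F) := by
    have h4 := detC_diagGL 1 ϖ one_ne_zero hirr.ne_zero
    rw [map_one, one_mul] at h4
    exact h4
  have h5 : (embA ϖ : CInf F) ^ (k - m) * embA ϖ ^ (m - n) =
      embA ϖ ^ h * embA ϖ ^ (k - n - h) := by
    rw [← zpow_add₀ hϖ, ← zpow_natCast, ← zpow_add₀ hϖ]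
    congr 1
    ring
  -- $U_{\mathfrak p}$ acts in weight $k-2h$ and type $m-h$, so its normalising power of $\wp$ falls
  -- short of that of $T_{\mathfrak p}$ by exactly $h$.
  have h6 : (embA ϖ : CInf F) ^ (k - m) = embA ϖ ^ h * embA ϖ ^ (k - 2 * h - (m - h)) := by
    rw [← zpow_natCast, ← zpow_add₀ hϖ]
    congr 1
    ring
  rw [h1, Finset.sum_congr rfl h2, hecke, h3, mul_add, mul_add,
    ← mul_assoc (embA ϖ ^ h) (embA ϖ ^ (k - 2 * h - (m - h))), ← h6]
  congr 1
  linear_combination degeneracy ϖ hirr.ne_zero f z * (-stabE π ϖ hirr.ne_zero z) ^ (n - h) * h5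

end

end DrinfeldQM
end

open DrinfeldQM
theorem theorem5p11 {F : Type*} [Field F] [Fintype F]
    (π : CInf F) (hπ : IsCarlitzPeriod π)
    (𝔪 : Ideal F[X]) (h𝔪 : 𝔪 ≠ ⊥)
    (ϖ : F[X]) (hmonic : ϖ.Monic) (hirr : Irreducible ϖ) (hndvd : ¬ Ideal.span {ϖ} ∣ 𝔪)
    (k m : ℤ) (n : ℕ) (f : Omega F → CInf F)
    (hf : IsModularForm (Gamma0 𝔪) (k - 2 * n) (m - n) f)
    (RT : Finset (GL (Fin 2) (RatFunc F)))
    (hRT : IsCosetReps (Gamma0 𝔪) (heckeMat ϖ hirr.ne_zero) RT)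
    (RU : Finset (GL (Fin 2) (RatFunc F)))
    (hRU : IsCosetReps (Gamma0 (𝔪 * Ideal.span {ϖ})) (heckeMat ϖ hirr.ne_zero) RU) :
    IsQuasiModularForm (Gamma0 𝔪) k m n (fun z => f z * falseE π z ^ n) ∧
    (∀ h ≤ n, IsModularForm (Gamma0 (𝔪 * Ideal.span {ϖ})) (k - 2 * h) (m - h)
      (fun z => f z * stabE π ϖ hirr.ne_zero z ^ (n - h))) ∧
    HasEExpansion π (Gamma0 𝔪) k m n
      (hecke (Gamma0 𝔪) (heckeMat ϖ hirr.ne_zero) RT k m (fun z => f z * falseE π z ^ n))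
      (fun h z => (n.choose h : CInf F) * embA ϖ ^ h *
        (embA ϖ ^ (k - n - h) * degeneracy ϖ hirr.ne_zero f z *
            (-stabE π ϖ hirr.ne_zero z) ^ (n - h) +
          hecke (Gamma0 (𝔪 * Ideal.span {ϖ})) (heckeMat ϖ hirr.ne_zero) RU (k - 2 * h) (m - h)
            (fun w => f w * stabE π ϖ hirr.ne_zero w ^ (n - h)) z)) := by
  refine ⟨hf.mul_falseE_pow π, fun h hn => hf.mul_stabE_pow π hirr.ne_zero hn, ?_⟩
  have hdet : detC (heckeMat ϖ hirr.ne_zero) = (embA ϖ : CInf F) := by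
    rw [heckeMat, detC_diagGL, map_one, one_mul]
  have hc : (fun (h : ℕ) (z : Omega F) => (n.choose h : CInf F) * embA ϖ ^ h *
        (embA ϖ ^ (k - n - h) * degeneracy ϖ hirr.ne_zero f z *
            (-stabE π ϖ hirr.ne_zero z) ^ (n - h) +
          hecke (Gamma0 (𝔪 * Ideal.span {ϖ})) (heckeMat ϖ hirr.ne_zero) RU (k - 2 * h) (m - h)
            (fun w => f w * stabE π ϖ hirr.ne_zero w ^ (n - h)) z)) =
      fun h z => (n.choose h : CInf F) * embA ϖ ^ (k - m) *
        ∑ γ ∈ RT, heckeTerm π k m n h f γ z := by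
    ext h z
    rcases le_or_gt h n with hn | hn
    · rw [mul_assoc, ← sum_heckeTerm_eq π h𝔪 hirr hndvd hf hRT hRU hn, ← mul_assoc]
    -- The coefficient family is indexed by all of $\mathbb N$. Beyond $n$ both sides vanish with
    -- the binomial coefficient.
    · rw [Nat.choose_eq_zero_of_lt hn]
      simp
  rw [hc, hecke_mul_falseE_pow π h𝔪 hf, hdet]
  exact hasEExpansion_sum (fun h hn => isModularForm_sum_heckeTerm π hRT hf hn _) h𝔪 hπ.1
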